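/- Let $m\ge 0$, let $G_1,G_2,G_3$ be finitely presented groups, and for $i=1,2,3$ let $1\to N_i\to G_i\xrightarrow{\phi_i}\mathbb{Z}^m\to 1$ be a right-split short exact sequence, i.e. there is a homomorphism $s_i:\mathbb{Z}^m\to G_i$ with $\phi_i\circ s_i=\mathrm{id}$. Let $\phi:G_1\times G_2\times G_3\to\mathbb{Z}^m$ be $\phi(g_1,g_2,g_3)=\phi_1(g_1)+\phi_2(g_2)+\phi_3(g_3)$ and let $K=\ker\phi$. Conventions. For a group $G$ with finite presentation $\langle X\mid R\rangle$ and a word $w$ in $X\sqcup X^{-1}$ that represents $1\in G$, let $\mathrm{Area}(w)$ be the least $l$ such that $w=\prod_{j=1}^{l}w_jr_jw_j^{-1}$ in the free group $F(X)$ for some $w_j\in F(X)$ and $r_j\in R^{\pm1}$; the Dehn function is $\delta_G(n)=\max\{\mathrm{Area}(w): w=_G 1,\ |w|\le n\}$. For functions $f,g$ of a positive integer, $f\preccurlyeq g$ means that there is a constant $C>0$ (which may be taken to be an integer) with $f(n)\le C\,g(Cn+C)+Cn+C$ for all $n\ge 1$, and $f\asymp g$ means $f\preccurlyeq g\preccurlyeq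 f$. Up to $\asymp$, the Dehn function does not depend on the finite presentation. A function $f:\mathbb{N}_{>0}\to\mathbb{R}$ is superadditive if $f(n+k)\ge f(n)+f(k)$ for all $n,k\ge 1$, and its superadditive closure $\overline{f}$ is the smallest superadditive function with $\overline{f}\ge f$. Theorem. The group $K$ is finitely presented. Moreover, let $f:\mathbb{N}_{>0}\to\mathbb{R}_{\ge 0}$ be the Dehn function of $G_1\times G_2\times G_3$ with respect to some finite presentation or, more generally, any non-decreasing function that is $\asymp$-equivalent to it, and let $\delta_K$ be the Dehn function of $K$ with respect to any finite presentation of $K$. Then $$f(n)\preccurlyeq\delta_K(n)\preccurlyeq \overline{f}(n)\cdot\log(n),$$ and if $n\mapsto f(n)/n$ is superadditive, then $\delta_K\asymp f$. -/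

import Mathlib

/-- A finite presentation `⟨X ∣ R⟩` of the group `G`, with `X = {x_0, …, x_{rank - 1}}`: a
surjection from the free group on `X` onto `G` whose kernel is the normal closure of the finite
set `R`. -/
structure FinitePresentation (G : Type*) [Group G] where
  /-- the number of generators -/
  rank : ℕ
  /-- the homomorphism from the free group that evaluates words in `G` -/
  eval : FreeGroup (Fin rank) →* G
  /-- the set of relators -/
  rels : Set (FreeGroup (Fin rank))
  surjective_eval : Function.Surjective eval
  finite_rels : rels.Finite
  normalClosure_rels : Subgroup.normalClosure rels = eval.ker

theorem nonempty_finitePresentation_iff (G : Type*) [Group G] :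
    Nonempty (FinitePresentation G) ↔ Group.IsFinitelyPresented G := by
  constructor
  · rintro ⟨P⟩
    exact ⟨P.rank, P.eval, P.surjective_eval, P.rels, P.finite_rels, P.normalClosure_rels⟩
  · rintro ⟨n, φ, hφ, R, hR, hker⟩
    exact ⟨⟨n, φ, R, hφ, hR, hker⟩⟩

namespace FinitePresentation

variable {G : Type*} [Group G] (P : FinitePresentation G)

/-- Words in the generators: elements of the free monoid on `X ⊔ X⁻¹` (not necessarily reduced).
The letter `(x, true)` stands for `x` and `(x, false)` for `x⁻¹`. -/
abbrev Word : Type := List (Fin P.rank × Bool)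

/-- The word `w` represents the trivial element of `G`. -/
def IsNull (w : P.Word) : Prop := P.eval (FreeGroup.mk w) = 1

/-- In the free group on `X`, the word `w` is equal to a product of `l` conjugates
`u * r * u⁻¹` of elements `r ∈ R ∪ R⁻¹`. -/
def HasFilling (w : P.Word) (l : ℕ) : Prop :=
  ∃ L : List (FreeGroup (Fin P.rank) × FreeGroup (Fin P.rank)),
    L.length = l ∧ (∀ p ∈ L, p.2 ∈ P.rels ∨ p.2⁻¹ ∈ P.rels) ∧
      FreeGroup.mk w = (L.map fun p => p.1 * p.2 * p.1⁻¹).prod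

/-- The area of a word that represents the trivial element: the minimal number of conjugates of
relators in a filling. -/
noncomputable def area (w : P.Word) : ℕ := sInf {l | P.HasFilling w l}

/-- The Dehn function of the presentation: the maximal area of a word of length at most `n` that
represents the trivial element. -/
noncomputable def dehn (n : ℕ) : ℕ :=
  sSup {a | ∃ w : P.Word, P.IsNull w ∧ w.length ≤ n ∧ P.area w = a}

/-- A word that represents the trivial element has a filling, so its area is a minimum over a
non-empty set. -/
theorem exists_hasFilling {w : P.Word} (hw : P.IsNull w) : ∃ l, P.HasFilling w l := by
  have key : ∀ g ∈ Subgroup.normalClosure P.rels,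
      ∃ L : List (FreeGroup (Fin P.rank) × FreeGroup (Fin P.rank)),
        (∀ p ∈ L, p.2 ∈ P.rels ∨ p.2⁻¹ ∈ P.rels) ∧
          g = (L.map fun p => p.1 * p.2 * p.1⁻¹).prod := by
    intro g hg
    induction hg using Subgroup.closure_induction with
    | mem x hx =>
      obtain ⟨r, hr, u, hu⟩ := by simpa [Group.mem_conjugatesOfSet_iff, isConj_iff] using hx
      exact ⟨[(u, r)], by simp [hr], by simp [hu]⟩
    | one => exact ⟨[], by simp, by simp⟩
    | mul x y _ _ hx hy =>
      obtain ⟨L, hL, rfl⟩ := hx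
      obtain ⟨M, hM, rfl⟩ := hy
      refine ⟨L ++ M, fun p hp => ?_, by simp⟩
      rcases List.mem_append.1 hp with h | h
      exacts [hL p h, hM p h]
    | inv x _ hx =>
      obtain ⟨L, hL, rfl⟩ := hx
      refine ⟨(L.map fun p => (p.1, p.2⁻¹)).reverse, fun p hp => ?_, ?_⟩
      · obtain ⟨u, r, hq, rfl⟩ := by simpa using hp
        simpa [or_comm] using hL (u, r) hq
      · rw [List.prod_inv_reverse, List.map_reverse, List.map_map, List.map_map]
        simp [Function.comp_def, mul_assoc]
  obtain ⟨L, hL, h⟩ := key (FreeGroup.mk w) (by rw [P.normalClosure_rels]; exact hw)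
  exact ⟨L.length, L, rfl, hL, h⟩

/-- The supremum in the definition of the Dehn function is a maximum over a finite set. -/
theorem finite_areas (n : ℕ) :
    {a | ∃ w : P.Word, P.IsNull w ∧ w.length ≤ n ∧ P.area w = a}.Finite := by
  refine ((List.finite_length_le (Fin P.rank × Bool) n).image P.area).subset ?_
  rintro a ⟨w, -, hw, rfl⟩
  exact ⟨w, hw, rfl⟩

end FinitePresentation

/-- The asymptotic preorder `f ≼ g` on functions of a positive integer:
`f n ≤ C g(C n + C) + C n + C` for a constant `C`. -/
def AsympLE (f g : ℕ → ℝ) : Prop :=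
  ∃ C : ℕ, 0 < C ∧ ∀ n : ℕ, 0 < n → f n ≤ C * g (C * n + C) + C * n + C

/-- Asymptotic equivalence `f ≍ g`. -/
def AsympEq (f g : ℕ → ℝ) : Prop := AsympLE f g ∧ AsympLE g f

/-- Superadditivity of a function of a positive integer (the value at `0` plays no role). -/
def Superadditive (f : ℕ → ℝ) : Prop :=
  ∀ n k : ℕ, 0 < n → 0 < k → f n + f k ≤ f (n + k)

/-- The superadditive functions of a positive integer that are bounded below by `f`. -/
def superadditiveMajorants (f : ℕ → ℝ) : Set (ℕ → ℝ) :=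
  {g | Superadditive g ∧ ∀ n, 0 < n → f n ≤ g n}

/-- The superadditive closure of `f`: the smallest superadditive function of a positive integer
that is bounded below by `f` (see `superadditiveClosure_mem` and `superadditiveClosure_le`). -/
noncomputable def superadditiveClosure (f : ℕ → ℝ) (n : ℕ) : ℝ :=
  sInf ((fun g : ℕ → ℝ => g n) '' superadditiveMajorants f)

theorem superadditiveMajorants_nonempty (f : ℕ → ℝ) : (superadditiveMajorants f).Nonempty := by
  refine ⟨fun n => n * ∑ i ∈ Finset.range (n + 1), |f i|, fun n k _ _ => ?_, fun n hn => ?_⟩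
  · have h1 : ∑ i ∈ Finset.range (n + 1), |f i| ≤ ∑ i ∈ Finset.range (n + k + 1), |f i| :=
      Finset.sum_le_sum_of_subset_of_nonneg (Finset.range_mono (by omega)) (by simp)
    have h2 : ∑ i ∈ Finset.range (k + 1), |f i| ≤ ∑ i ∈ Finset.range (n + k + 1), |f i| :=
      Finset.sum_le_sum_of_subset_of_nonneg (Finset.range_mono (by omega)) (by simp)
    push_cast
    rw [add_mul]
    gcongr
  · have h1 : |f n| ≤ ∑ i ∈ Finset.range (n + 1), |f i| :=
      Finset.single_le_sum (f := fun i => |f i|) (by simp) (by simp)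
    have h2 : (1 : ℝ) ≤ n := by exact_mod_cast hn
    nlinarith [le_abs_self (f n), abs_nonneg (f n)]

theorem superadditiveClosure_le {f g : ℕ → ℝ} (hg : g ∈ superadditiveMajorants f) {n : ℕ}
    (hn : 0 < n) : superadditiveClosure f n ≤ g n := by
  refine csInf_le ⟨f n, ?_⟩ ⟨g, hg, rfl⟩
  rintro _ ⟨h, hh, rfl⟩
  exact hh.2 n hn

theorem superadditiveClosure_mem (f : ℕ → ℝ) :
    superadditiveClosure f ∈ superadditiveMajorants f := by
  refine ⟨fun n k hn hk => ?_, fun n hn => ?_⟩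
  · refine le_csInf ((superadditiveMajorants_nonempty f).image _) ?_
    rintro _ ⟨g, hg, rfl⟩
    exact (add_le_add (superadditiveClosure_le hg hn) (superadditiveClosure_le hg hk)).trans
      (hg.1 n k hn hk)
  · refine le_csInf ((superadditiveMajorants_nonempty f).image _) ?_
    rintro _ ⟨g, hg, rfl⟩
    exact hg.2 n hn

/-- The short exact sequence `1 → ker φ → G → Q → 1` is right-split: `φ` has a section which is a
homomorphism (in particular, `φ` is surjective). -/
def RightSplit {G Q : Type*} [Group G] [Group Q] (φ : G →* Q) : Prop :=
  ∃ s : Q →* G, φ.comp s = MonoidHom.id Q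

/-- The free abelian group `ℤ^m`, written multiplicatively. -/
abbrev FreeAb (m : ℕ) : Type := Multiplicative (Fin m → ℤ)

/-- The homomorphism `(g₁, g₂, g₃) ↦ φ₁ g₁ + φ₂ g₂ + φ₃ g₃` to `ℤ^m`
(a product in multiplicative notation). -/
def sumHom {G₁ G₂ G₃ : Type*} [Group G₁] [Group G₂] [Group G₃] {m : ℕ}
    (φ₁ : G₁ →* FreeAb m) (φ₂ : G₂ →* FreeAb m) (φ₃ : G₃ →* FreeAb m) :
    G₁ × G₂ × G₃ →* FreeAb m :=
  φ₁.coprod (φ₂.coprod φ₃)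

/-! Write `A`, `B`, `C` for the three groups. A section of the homomorphism on the third factor
embeds the product of any two factors in `K`: the missing coordinate is forced up to its kernel, and
the section chooses it.

Lower bound, for `m > 0`. Coordinate projections make `A` and `B × C` retracts of `K`, so their Dehn
functions are bounded by that of `K`. The Dehn function of `A × (B × C)` exceeds theirs only by a
quadratic term (`isFinitelyPresented_prod_and_dehn_le`). `K` pays for that term too: it contains two
commuting elements that map to a basis of `ℤ²`, and lifting to the Heisenberg group gives commutator
words with linear length and quadratic area (`exists_sq_le_dehn`).

Upper bound. Every element of `K` is an element of the copy of `A × B` times some `(1, 1, x)` with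
`x ∈ ker φ₃`, which gives a normal form with Lipschitz factors. The elements `(1, 1, x)` lie in the
copies of both `A × C` and `B × C`, so such an element can be conjugated by `A` inside one product,
passed to the other, and conjugated by `B` there. Hence the product of two normal forms is rewritten
to a normal form at a cost bounded by Dehn functions of pairs at linear arguments
(`exists_near_normalForm_mul`). Halving words repeatedly gives `S (k + 1) = 2 * S k + c * D (c * 2 ^
k) + c * 2 ^ k`, where `D` sums those Dehn functions. In general each of the `k ≈ log n` levels
costs at most the superadditive closure, whence the logarithm; if `f n / n` is superadditive, then
`f (2 * n) ≥ 4 * f n`, and the sum over levels is geometric. -/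

/-! ### Fillings, and equality up to a bounded number of relators. -/

/-- `g` is a product of at most `k` conjugates of elements of `R ∪ R⁻¹`. -/
def FillsIn {F : Type*} [Group F] (R : Set F) (k : ℕ) (g : F) : Prop :=
  ∃ L : List (F × F), L.length ≤ k ∧ (∀ p ∈ L, p.2 ∈ R ∨ p.2⁻¹ ∈ R) ∧
    g = (L.map fun p => p.1 * p.2 * p.1⁻¹).prod

namespace FillsIn

variable {F F' : Type*} [Group F] [Group F'] {R : Set F} {R' : Set F'} {k l : ℕ} {g h : F}

theorem one (R : Set F) : FillsIn R 0 (1 : F) := ⟨[], by simp, by simp, by simp⟩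

theorem mono (hg : FillsIn R k g) (hkl : k ≤ l) : FillsIn R l g := by
  obtain ⟨L, hL, h⟩ := hg
  exact ⟨L, hL.trans hkl, h⟩

theorem of_mem (hg : g ∈ R) : FillsIn R 1 g := ⟨[(1, g)], by simp, by simp [hg], by simp⟩

theorem mul (hg : FillsIn R k g) (hh : FillsIn R l h) : FillsIn R (k + l) (g * h) := by
  obtain ⟨L, hL, hLR, rfl⟩ := hg
  obtain ⟨M, hM, hMR, rfl⟩ := hh
  refine ⟨L ++ M, by simpa using add_le_add hL hM, fun p hp => ?_, by simp⟩
  rcases List.mem_append.1 hp with h | h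
  exacts [hLR p h, hMR p h]

theorem inv (hg : FillsIn R k g) : FillsIn R k g⁻¹ := by
  obtain ⟨L, hL, hLR, rfl⟩ := hg
  refine ⟨(L.map fun p => (p.1, p.2⁻¹)).reverse, by simpa using hL, fun p hp => ?_, ?_⟩
  · obtain ⟨u, r, hq, rfl⟩ := by simpa using hp
    simpa [or_comm] using hLR (u, r) hq
  · rw [List.prod_inv_reverse, List.map_reverse, List.map_map, List.map_map]
    simp [Function.comp_def, mul_assoc]

theorem conj (hg : FillsIn R k g) (u : F) : FillsIn R k (u * g * u⁻¹) := by
  obtain ⟨L, hL, hLR, rfl⟩ := hg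
  refine ⟨L.map fun p => (u * p.1, p.2), by simpa using hL, fun p hp => ?_, ?_⟩
  · obtain ⟨v, r, hq, rfl⟩ := by simpa using hp
    exact hLR (v, r) hq
  · clear hL hLR
    induction L with
    | nil => simp
    | cons p L ih =>
      simp only [List.map_cons, List.prod_cons] at ih ⊢
      rw [← ih]
      group

/-- Reduces any estimate on fillings to its effect on one extra conjugate of a relator; monotonicity
in the count accounts for "at most `k`". -/
theorem induction {p : ℕ → F → Prop} (hone : p 0 1)
    (hmul : ∀ k u r g, r ∈ R ∨ r⁻¹ ∈ R → p k g → p (k + 1) (u * r * u⁻¹ * g))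
    (hmono : ∀ k l g, k ≤ l → p k g → p l g) (hg : FillsIn R k g) : p k g := by
  obtain ⟨L, hL, hLR, rfl⟩ := hg
  refine hmono _ _ _ hL ?_
  clear hL
  induction L with
  | nil => simpa using hone
  | cons q L ih =>
    simp only [List.map_cons, List.prod_cons, List.length_cons]
    exact hmul _ _ _ _ (hLR q (by simp)) (ih fun p hp => hLR p (by simp [hp]))

theorem map (θ : F →* F') {c : ℕ} (hθ : ∀ r ∈ R, FillsIn R' c (θ r)) (hg : FillsIn R k g) :
    FillsIn R' (c * k) (θ g) := by
  refine hg.induction (p := fun k g => FillsIn R' (c * k) (θ g)) ?_ ?_ ?_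
  · simpa using one R'
  · intro k u r g hr hg
    have h1 : FillsIn R' c (θ r) := by
      rcases hr with hr | hr
      · exact hθ r hr
      · simpa using (hθ _ hr).inv
    have := (h1.conj (θ u)).mul hg
    simp only [map_mul, map_inv]
    exact this.mono (by ring_nf; rfl)
  · exact fun k l g hkl hg => hg.mono (Nat.mul_le_mul_left c hkl)

theorem mem_normalClosure (hg : FillsIn R k g) : g ∈ Subgroup.normalClosure R := by
  refine hg.induction (p := fun _ g => g ∈ Subgroup.normalClosure R) (one_mem _) ?_ ?_
  · intro k u r g hr hg
    refine mul_mem (Subgroup.normalClosure_normal.conj_mem r ?_ u) hg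
    rcases hr with hr | hr
    · exact Subgroup.subset_normalClosure hr
    · exact inv_mem_iff.1 (Subgroup.subset_normalClosure hr)
  · exact fun _ _ _ _ h => h

theorem map_eq_one (θ : F →* F') (hθ : ∀ r ∈ R, θ r = 1) (hg : FillsIn R k g) : θ g = 1 := by
  have : Subgroup.normalClosure R ≤ θ.ker := Subgroup.normalClosure_le_normal hθ
  exact this hg.mem_normalClosure

theorem exists_of_mem_normalClosure (hg : g ∈ Subgroup.normalClosure R) :
    ∃ k, FillsIn R k g := by
  induction hg using Subgroup.closure_induction with
  | mem x hx =>
    obtain ⟨r, hr, u, hu⟩ := by simpa [Group.mem_conjugatesOfSet_iff, isConj_iff] using hx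
    exact ⟨1, hu ▸ (of_mem hr).conj u⟩
  | one => exact ⟨0, one R⟩
  | mul x y _ _ hx hy =>
    obtain ⟨k, hk⟩ := hx
    obtain ⟨l, hl⟩ := hy
    exact ⟨k + l, hk.mul hl⟩
  | inv x _ hx =>
    obtain ⟨k, hk⟩ := hx
    exact ⟨k, hk.inv⟩

end FillsIn

/-- `g` and `h` differ by a product of at most `k` conjugates of elements of `R ∪ R⁻¹`. -/
def Near {F : Type*} [Group F] (R : Set F) (k : ℕ) (g h : F) : Prop := FillsIn R k (g * h⁻¹)

namespace Near

variable {F F' : Type*} [Group F] [Group F'] {R : Set F} {R' : Set F'} {k l : ℕ}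
  {g h g' h' u : F}

theorem refl (R : Set F) (g : F) : Near R 0 g g := by
  simpa [Near] using FillsIn.one R

theorem mono (hg : Near R k g h) (hkl : k ≤ l) : Near R l g h := FillsIn.mono hg hkl

theorem symm (hg : Near R k g h) : Near R k h g := by
  simpa [Near] using FillsIn.inv hg

theorem trans (hg : Near R k g h) (hh : Near R l h u) : Near R (k + l) g u := by
  simpa [Near, mul_assoc] using FillsIn.mul hg hh

theorem mul (hg : Near R k g h) (hg' : Near R l g' h') : Near R (k + l) (g * g') (h * h') := by
  -- The quotient factors as `g g' h'⁻¹ h⁻¹ = (g (g' h'⁻¹) g⁻¹) (g h⁻¹)`, and conjugation does not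
  -- change the cost.
  have := FillsIn.mul (FillsIn.conj hg' g) hg
  rw [add_comm]
  unfold Near
  convert this using 1
  group

theorem mul_left (u : F) (hg : Near R k g h) : Near R k (u * g) (u * h) := by
  simpa using (refl R u).mul hg

theorem mul_right (hg : Near R k g h) (u : F) : Near R k (g * u) (h * u) := by
  simpa using hg.mul (refl R u)

theorem inv (hg : Near R k g h) : Near R k g⁻¹ h⁻¹ := by
  have := FillsIn.conj (symm hg) g⁻¹
  unfold Near
  convert this using 1
  group

theorem one_right_iff : Near R k g 1 ↔ FillsIn R k g := by simp [Near]

theorem map (θ : F →* F') {c : ℕ} (hθ : ∀ r ∈ R, FillsIn R' c (θ r)) (hg : Near R k g h) :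
    Near R' (c * k) (θ g) (θ h) := by
  simpa [Near] using FillsIn.map θ hθ hg

theorem map_eq (θ : F →* F') (hθ : ∀ r ∈ R, θ r = 1) (hg : Near R k g h) : θ g = θ h := by
  have := FillsIn.map_eq_one θ hθ hg
  rwa [map_mul, map_inv, mul_inv_eq_one] at this

end Near

/-- Finitely many elements of a normal closure have fillings of uniformly bounded size. -/
theorem exists_uniform_fillsIn {ι F : Type*} [Group F] {R : Set F} {S : Set ι} (hS : S.Finite)
    (a : ι → F) (ha : ∀ i ∈ S, ∃ k, FillsIn R k (a i)) :
    ∃ c, ∀ i ∈ S, FillsIn R c (a i) := by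
  induction S, hS using Set.Finite.induction_on with
  | empty => exact ⟨0, by simp⟩
  | @insert i S _ _ ih =>
    obtain ⟨c, hc⟩ := ih fun j hj => ha j (by simp [hj])
    obtain ⟨k, hk⟩ := ha i (by simp)
    refine ⟨c + k, fun j hj => ?_⟩
    rcases Set.mem_insert_iff.1 hj with rfl | hj
    · exact hk.mono (by omega)
    · exact (hc j hj).mono (by omega)

/-! ### Lifting homomorphisms to free groups with linear control of length. -/

namespace FreeGroup

theorem exists_lift_of_surjective {α E H : Type*} [Group E] [Group H] {ev : E →* H}
    (hev : Function.Surjective ev) (θ : FreeGroup α →* H) :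
    ∃ θ' : FreeGroup α →* E, ∀ g, ev (θ' g) = θ g := by
  choose s hs using hev
  refine ⟨FreeGroup.lift fun x => s (θ (of x)), fun g => ?_⟩
  have : ev.comp (FreeGroup.lift fun x => s (θ (of x))) = θ := by
    ext x
    simp [hs]
  exact DFunLike.congr_fun this g

variable {α β : Type*} [DecidableEq α] [DecidableEq β]

/-- Two homomorphisms that nearly agree on the generators nearly agree on every element, with
an error that is linear in its length. -/
theorem near_of_near_of {F : Type*} [Group F] {R : Set F} {c : ℕ} {θ θ' : FreeGroup α →* F}
    (h : ∀ x, Near R c (θ (of x)) (θ' (of x))) (g : FreeGroup α) :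
    Near R (c * g.norm) (θ g) (θ' g) := by
  suffices H : ∀ w : List (α × Bool), Near R (c * w.length) (θ (mk w)) (θ' (mk w)) by
    simpa [norm, mk_toWord] using H g.toWord
  intro w
  induction w with
  | nil => simpa [← one_eq_mk] using Near.refl R 1
  | cons p w ih =>
    have h1 : Near R c (θ (mk [p])) (θ' (mk [p])) := by
      obtain ⟨x, b⟩ := p
      cases b
      · have : (mk [(x, false)] : FreeGroup α) = (of x)⁻¹ := rfl
        rw [this, _root_.map_inv, _root_.map_inv]
        exact (h x).inv
      · exact h x
    have : (mk (p :: w) : FreeGroup α) = mk [p] * mk w := rfl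
    rw [this, _root_.map_mul, _root_.map_mul]
    exact (h1.mul ih).mono (by simp [mul_add, add_comm])

theorem exists_norm_map_le [Finite α] (θ : FreeGroup α →* FreeGroup β) :
    ∃ c, ∀ g, (θ g).norm ≤ c * g.norm := by
  obtain ⟨c, hc⟩ := (Set.finite_range fun x => (θ (of x)).norm).bddAbove
  refine ⟨c, fun g => ?_⟩
  suffices H : ∀ w : List (α × Bool), (θ (mk w)).norm ≤ c * w.length by
    simpa [norm, mk_toWord] using H g.toWord
  intro w
  induction w with
  | nil => simp [← one_eq_mk]
  | cons p w ih =>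
    have h1 : (θ (mk [p])).norm ≤ c := by
      obtain ⟨x, b⟩ := p
      have hx : (θ (of x)).norm ≤ c := hc ⟨x, rfl⟩
      cases b
      · have : (mk [(x, false)] : FreeGroup α) = (of x)⁻¹ := rfl
        rwa [this, _root_.map_inv, norm_inv_eq]
      · exact hx
    have : (mk (p :: w) : FreeGroup α) = mk [p] * mk w := rfl
    rw [this, _root_.map_mul, List.length_cons, mul_add, mul_one, add_comm]
    exact (norm_mul_le _ _).trans (add_le_add h1 ih)

/-- A lift of a homomorphism to free groups, together with its Lipschitz constant. -/
theorem exists_lipschitz_lift [Finite α] {H : Type*} [Group H] {ev : FreeGroup β →* H}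
    (hev : Function.Surjective ev) (θ : FreeGroup α →* H) :
    ∃ (θ' : FreeGroup α →* FreeGroup β) (c : ℕ),
      (∀ g, ev (θ' g) = θ g) ∧ ∀ g, (θ' g).norm ≤ c * g.norm := by
  obtain ⟨θ', h⟩ := exists_lift_of_surjective hev θ
  obtain ⟨c, hc⟩ := exists_norm_map_le θ'
  exact ⟨θ', c, h, hc⟩

end FreeGroup

/-! ### Dehn functions of presentations and of retracts. -/

namespace FinitePresentation

variable {G H : Type*} [Group G] [Group H] (P : FinitePresentation G)

theorem eval_eq_one_of_mem_rels {r : FreeGroup (Fin P.rank)} (hr : r ∈ P.rels) :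
    P.eval r = 1 := by
  have h : r ∈ P.eval.ker := P.normalClosure_rels ▸ Subgroup.subset_normalClosure hr
  exact h

theorem exists_fillsIn {g : FreeGroup (Fin P.rank)} (hg : P.eval g = 1) :
    ∃ k, FillsIn P.rels k g :=
  FillsIn.exists_of_mem_normalClosure (by rw [P.normalClosure_rels]; exact hg)

theorem fillsIn_dehn {g : FreeGroup (Fin P.rank)} (hg : P.eval g = 1) {n : ℕ}
    (hn : g.norm ≤ n) : FillsIn P.rels (P.dehn n) g := by
  have hnull : P.IsNull g.toWord := by rwa [IsNull, FreeGroup.mk_toWord]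
  obtain ⟨L, hL, hLR, h⟩ := Nat.sInf_mem (s := {l | P.HasFilling g.toWord l})
    (P.exists_hasFilling hnull)
  refine ⟨L, hL.le.trans ?_, hLR, by rwa [FreeGroup.mk_toWord] at h⟩
  exact le_csSup (P.finite_areas n).bddAbove ⟨g.toWord, hnull, hn, rfl⟩

theorem near_dehn {g h : FreeGroup (Fin P.rank)} (hgh : P.eval g = P.eval h) {n : ℕ}
    (hn : g.norm + h.norm ≤ n) : Near P.rels (P.dehn n) g h := by
  refine P.fillsIn_dehn (by simp [hgh]) ((FreeGroup.norm_mul_le _ _).trans ?_)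
  simpa using hn

/-- Fillings see only the element of the free group, and free reduction does not lengthen a word, so
bounds in terms of `FreeGroup.norm` suffice. -/
theorem dehn_le {n k : ℕ}
    (h : ∀ g : FreeGroup (Fin P.rank), P.eval g = 1 → g.norm ≤ n → FillsIn P.rels k g) :
    P.dehn n ≤ k := by
  -- The empty word makes the set of areas nonempty.
  refine csSup_le ⟨_, [], by simp [IsNull, ← FreeGroup.one_eq_mk], by simp, rfl⟩ ?_
  rintro _ ⟨w, hw, hn, rfl⟩
  obtain ⟨L, hL, hLR, h⟩ := h (FreeGroup.mk w) hw (FreeGroup.norm_mk_le.trans hn)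
  exact (Nat.sInf_le (s := {l | P.HasFilling w l}) ⟨L, rfl, hLR, h⟩).trans hL

theorem dehn_mono : Monotone P.dehn := fun _ _ hnk =>
  P.dehn_le fun _ hg hn => P.fillsIn_dehn hg (hn.trans hnk)

/-- If `G` is a retract of `H`, then the Dehn function of `G` is bounded by any function that
bounds fillings over `H`. -/
theorem exists_dehn_le_of_retract {α : Type*} [Finite α] [DecidableEq α]
    (i : G →* H) (r : H →* G) (hri : ∀ g, r (i g) = g)
    {ev : FreeGroup α →* H} (hev : Function.Surjective ev) {R : Set (FreeGroup α)}
    (hR : R.Finite) (hRev : ∀ g ∈ R, ev g = 1) {B : ℕ → ℕ} (hB : Monotone B)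
    (hfill : ∀ g, ev g = 1 → FillsIn R (B g.norm) g) :
    ∃ C, 0 < C ∧ ∀ n, P.dehn n ≤ C * B (C * n) + C * n := by
  obtain ⟨a, c, ha, hc⟩ := FreeGroup.exists_lipschitz_lift hev (i.comp P.eval)
  obtain ⟨b, hb⟩ := FreeGroup.exists_lift_of_surjective P.surjective_eval (r.comp ev)
  -- A null word over `G` is sent by `a` to a null word over `H`, filled there, and sent back by
  -- `b`. The constant `d` bounds the area of the image of a relator of `H`; `e` bounds, for each
  -- letter, the discrepancy between `b ∘ a` and the identity.
  obtain ⟨d, hd⟩ := exists_uniform_fillsIn hR b fun g hg =>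
    P.exists_fillsIn (by rw [hb]; simp [hRev g hg])
  obtain ⟨e, he⟩ := exists_uniform_fillsIn (R := P.rels) (Set.finite_univ (α := Fin P.rank))
    (fun x => FreeGroup.of x * (b (a (FreeGroup.of x)))⁻¹) fun x _ =>
      P.exists_fillsIn (by simp [hb, ha, hri])
  refine ⟨c + d + e + 1, by omega, fun n => P.dehn_le fun g hg hn => ?_⟩
  have h1 : FillsIn P.rels (d * B (a g).norm) (b (a g)) :=
    (hfill (a g) (by simp [ha, hg])).map b hd
  have h2 : Near P.rels (e * g.norm) g (b (a g)) :=
    FreeGroup.near_of_near_of (θ := MonoidHom.id _) (θ' := b.comp a)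
      (fun x => he x (Set.mem_univ x)) g
  rw [← Near.one_right_iff] at h1 ⊢
  refine (h2.trans h1).mono ?_
  rw [add_comm]
  have hle : (a g).norm ≤ (c + d + e + 1) * n :=
    (hc g).trans (Nat.mul_le_mul (by omega) hn)
  exact add_le_add (Nat.mul_le_mul (by omega) (hB hle)) (Nat.mul_le_mul (by omega) hn)

theorem exists_dehn_le_dehn_of_retract (Q : FinitePresentation H)
    (i : G →* H) (r : H →* G) (hri : ∀ g, r (i g) = g) :
    ∃ C, 0 < C ∧ ∀ n, P.dehn n ≤ C * Q.dehn (C * n) + C * n :=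
  P.exists_dehn_le_of_retract i r hri Q.surjective_eval Q.finite_rels
    (fun _ h => Q.eval_eq_one_of_mem_rels h) Q.dehn_mono fun _ hg => Q.fillsIn_dehn hg le_rfl

end FinitePresentation

/-- The qualitative half of a filling bound: fillability of all null words already identifies the
normal closure of `R` with the kernel. -/
theorem Group.isFinitelyPresented_of_fillsIn {α H : Type*} [Group H] [Finite α]
    {ev : FreeGroup α →* H} (hev : Function.Surjective ev) {R : Set (FreeGroup α)}
    (hR : R.Finite) (hRev : ∀ g ∈ R, ev g = 1) (hfill : ∀ g, ev g = 1 → ∃ k, FillsIn R k g) :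
    Group.IsFinitelyPresented H := by
  refine Group.IsFinitelyPresented.of_surjective ev hev ⟨R, hR, le_antisymm ?_ fun g hg => ?_⟩
  · exact Subgroup.normalClosure_le_normal hRev
  · obtain ⟨k, hk⟩ := hfill g hg
    exact hk.mem_normalClosure

/-! ### The quadratic lower bound from the Heisenberg group. -/

/-- The integral Heisenberg group. -/
@[ext]
structure Heisenberg where
  /-- the first coordinate of the abelianization -/
  x : ℤ
  /-- the second coordinate of the abelianization -/
  y : ℤ
  /-- the central coordinate -/
  z : ℤ

namespace Heisenberg

instance : Mul Heisenberg := ⟨fun g h => ⟨g.x + h.x, g.y + h.y, g.z + h.z + g.x * h.y⟩⟩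
instance : One Heisenberg := ⟨⟨0, 0, 0⟩⟩
instance : Inv Heisenberg := ⟨fun g => ⟨-g.x, -g.y, -g.z + g.x * g.y⟩⟩

@[simp] theorem mul_x (g h : Heisenberg) : (g * h).x = g.x + h.x := rfl
@[simp] theorem mul_y (g h : Heisenberg) : (g * h).y = g.y + h.y := rfl
@[simp] theorem mul_z (g h : Heisenberg) : (g * h).z = g.z + h.z + g.x * h.y := rfl
@[simp] theorem one_x : (1 : Heisenberg).x = 0 := rfl
@[simp] theorem one_y : (1 : Heisenberg).y = 0 := rfl
@[simp] theorem one_z : (1 : Heisenberg).z = 0 := rfl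
@[simp] theorem inv_x (g : Heisenberg) : g⁻¹.x = -g.x := rfl
@[simp] theorem inv_y (g : Heisenberg) : g⁻¹.y = -g.y := rfl
@[simp] theorem inv_z (g : Heisenberg) : g⁻¹.z = -g.z + g.x * g.y := rfl

instance : Group Heisenberg :=
  Group.ofLeftAxioms (fun a b c => by ext <;> simp <;> ring) (fun a => by ext <;> simp)
    (fun a => by ext <;> simp)

/-- The abelianization map. -/
def toProd : Heisenberg →* Multiplicative ℤ × Multiplicative ℤ where
  toFun g := (Multiplicative.ofAdd g.x, Multiplicative.ofAdd g.y)
  map_one' := rfl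
  map_mul' _ _ := rfl

theorem toProd_surjective : Function.Surjective toProd := fun p =>
  ⟨⟨p.1.toAdd, p.2.toAdd, 0⟩, rfl⟩

theorem toProd_eq_one_iff {g : Heisenberg} : toProd g = 1 ↔ g.x = 0 ∧ g.y = 0 := by
  simp [toProd, Prod.ext_iff]

theorem commutator_z (g h : Heisenberg) :
    (g * h * g⁻¹ * h⁻¹).z = g.x * h.y - h.x * g.y := by
  simp
  ring

theorem pow_x (g : Heisenberg) (n : ℕ) : (g ^ n).x = n * g.x := by
  induction n with
  | zero => simp
  | succ n ih => rw [pow_succ, mul_x, ih]; push_cast; ring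

theorem pow_y (g : Heisenberg) (n : ℕ) : (g ^ n).y = n * g.y := by
  induction n with
  | zero => simp
  | succ n ih => rw [pow_succ, mul_y, ih]; push_cast; ring

end Heisenberg

namespace FreeGroup

theorem norm_pow_le {α : Type*} [DecidableEq α] (g : FreeGroup α) (n : ℕ) :
    (g ^ n).norm ≤ n * g.norm := by
  induction n with
  | zero => simp
  | succ n ih =>
    rw [pow_succ, Nat.add_mul, one_mul]
    exact (norm_mul_le _ _).trans (Nat.add_le_add_right ih _)

end FreeGroup

namespace FinitePresentation

variable {G H : Type*} [Group G] [Group H]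

/-- A group that retracts onto a copy of `ℤ²` has at least quadratic Dehn function. -/
theorem exists_sq_le_dehn (Q : FinitePresentation G)
    (ψ : G →* Multiplicative ℤ × Multiplicative ℤ) {a b : G} (hab : a * b = b * a)
    (ha : ψ a = (Multiplicative.ofAdd 1, 1)) (hb : ψ b = (1, Multiplicative.ofAdd 1)) :
    ∃ C, 0 < C ∧ ∀ n, n ^ 2 ≤ C * Q.dehn (C * n) := by
  obtain ⟨θ, hθ⟩ := FreeGroup.exists_lift_of_surjective Heisenberg.toProd_surjective
    (ψ.comp Q.eval)
  obtain ⟨A, rfl⟩ := Q.surjective_eval a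
  obtain ⟨B, rfl⟩ := Q.surjective_eval b
  have hA := hθ A
  have hB := hθ B
  simp only [MonoidHom.comp_apply, ha, hb, Heisenberg.toProd, MonoidHom.coe_mk, OneHom.coe_mk,
    Prod.mk.injEq, EmbeddingLike.apply_eq_iff_eq, ofAdd_eq_one] at hA hB
  -- Relators die in `ℤ²`, so their images under `θ` are central, and there are finitely many. Thus
  -- `c` times the area bounds the central coordinate of a null word.
  obtain ⟨c, hc⟩ := (Q.finite_rels.image fun r => (θ r).z.natAbs).bddAbove
  have hrel : ∀ r, r ∈ Q.rels ∨ r⁻¹ ∈ Q.rels →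
      (θ r).x = 0 ∧ (θ r).y = 0 ∧ (θ r).z.natAbs ≤ c := by
    have key : ∀ r ∈ Q.rels, (θ r).x = 0 ∧ (θ r).y = 0 ∧ (θ r).z.natAbs ≤ c := fun r hr => by
      have h1 := hθ r
      rw [MonoidHom.comp_apply, Q.eval_eq_one_of_mem_rels hr, map_one,
        Heisenberg.toProd_eq_one_iff] at h1
      exact ⟨h1.1, h1.2, hc ⟨r, hr, rfl⟩⟩
    rintro r (hr | hr)
    · exact key r hr
    · have := key _ hr
      simp only [map_inv, Heisenberg.inv_x, Heisenberg.inv_y, Heisenberg.inv_z, neg_eq_zero] at this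
      obtain ⟨h1, h2, h3⟩ := this
      refine ⟨h1, h2, ?_⟩
      simpa [h1] using h3
  have hfill : ∀ k g, FillsIn Q.rels k g →
      (θ g).x = 0 ∧ (θ g).y = 0 ∧ (θ g).z.natAbs ≤ c * k := by
    intro k g hg
    refine hg.induction
      (p := fun k g => (θ g).x = 0 ∧ (θ g).y = 0 ∧ (θ g).z.natAbs ≤ c * k) ?_ ?_ ?_
    · simp
    · rintro k u r g hr ⟨h1, h2, h3⟩
      obtain ⟨r1, r2, r3⟩ := hrel r hr
      -- Centrality removes the conjugator `u`, so central coordinates simply add.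
      have hz : (θ (u * r * u⁻¹ * g)).z = (θ r).z + (θ g).z := by
        simp [h2, r1, r2]
        ring
      refine ⟨by simp [h1, r1], by simp [h2, r2], ?_⟩
      rw [hz, mul_add, mul_one]
      exact (Int.natAbs_add_le _ _).trans (by omega)
    · rintro k l g hkl ⟨h1, h2, h3⟩
      exact ⟨h1, h2, h3.trans (Nat.mul_le_mul_left c hkl)⟩
  refine ⟨c + 2 * (A.norm + B.norm) + 1, by omega, fun n => ?_⟩
  -- This commutator has length linear in `n`, is null because `a` and `b` commute, and has central
  -- coordinate `n ^ 2`.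
  set W := A ^ n * B ^ n * (A ^ n)⁻¹ * (B ^ n)⁻¹ with hW
  have hnull : Q.eval W = 1 := by
    have : Q.eval A ^ n * Q.eval B ^ n = Q.eval B ^ n * Q.eval A ^ n :=
      (Commute.pow_pow (show Commute (Q.eval A) (Q.eval B) from hab) n n).eq
    simp [hW, this]
  have hnorm : W.norm ≤ (c + 2 * (A.norm + B.norm) + 1) * n := by
    have h1 := FreeGroup.norm_mul_le (A ^ n * B ^ n * (A ^ n)⁻¹) (B ^ n)⁻¹
    have h2 := FreeGroup.norm_mul_le (A ^ n * B ^ n) (A ^ n)⁻¹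
    have h3 := FreeGroup.norm_mul_le (A ^ n) (B ^ n)
    have h4 := FreeGroup.norm_pow_le A n
    have h5 := FreeGroup.norm_pow_le B n
    rw [FreeGroup.norm_inv_eq] at h1 h2
    nlinarith [Nat.zero_le (c * n)]
  have h := (hfill _ _ (Q.fillsIn_dehn hnull hnorm)).2.2
  have hz : (θ W).z = (n : ℤ) ^ 2 := by
    rw [hW, map_mul, map_mul, map_mul, map_inv, map_inv, map_pow, map_pow,
      Heisenberg.commutator_z]
    simp only [Heisenberg.pow_x, Heisenberg.pow_y, hA, hB]
    ring
  rw [hz, Int.natAbs_pow, Int.natAbs_natCast] at h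
  exact h.trans (Nat.mul_le_mul_right _ (by omega))

/-! ### Dehn functions of direct products. -/

section Prod

variable (P : FinitePresentation G) (P' : FinitePresentation H)

/-- Direct products of finitely presented groups are finitely presented, and their Dehn function
is bounded by those of the factors and a quadratic term. -/
theorem isFinitelyPresented_prod_and_dehn_le :
    Group.IsFinitelyPresented (G × H) ∧ ∀ S : FinitePresentation (G × H),
      ∃ C, ∀ n, S.dehn n ≤ C * (P.dehn (C * n) + P'.dehn (C * n) + n ^ 2) := by
  let i₁ : FreeGroup (Fin P.rank) →* FreeGroup (Fin P.rank ⊕ Fin P'.rank) :=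
    FreeGroup.map Sum.inl
  let i₂ : FreeGroup (Fin P'.rank) →* FreeGroup (Fin P.rank ⊕ Fin P'.rank) :=
    FreeGroup.map Sum.inr
  let p₁ : FreeGroup (Fin P.rank ⊕ Fin P'.rank) →* FreeGroup (Fin P.rank) :=
    FreeGroup.lift (Sum.elim FreeGroup.of 1)
  let p₂ : FreeGroup (Fin P.rank ⊕ Fin P'.rank) →* FreeGroup (Fin P'.rank) :=
    FreeGroup.lift (Sum.elim 1 FreeGroup.of)
  let ev : FreeGroup (Fin P.rank ⊕ Fin P'.rank) →* G × H :=
    (P.eval.comp p₁).prod (P'.eval.comp p₂)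
  have hp₁i₁ : ∀ g, p₁ (i₁ g) = g := fun g => by
    have : p₁.comp i₁ = MonoidHom.id _ := by ext; simp [p₁, i₁]
    exact DFunLike.congr_fun this g
  have hp₁i₂ : ∀ g, p₁ (i₂ g) = 1 := fun g => by
    have : p₁.comp i₂ = 1 := by ext; simp [p₁, i₂]
    exact DFunLike.congr_fun this g
  have hp₂i₁ : ∀ g, p₂ (i₁ g) = 1 := fun g => by
    have : p₂.comp i₁ = 1 := by ext; simp [p₂, i₁]
    exact DFunLike.congr_fun this g
  have hp₂i₂ : ∀ g, p₂ (i₂ g) = g := fun g => by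
    have : p₂.comp i₂ = MonoidHom.id _ := by ext; simp [p₂, i₂]
    exact DFunLike.congr_fun this g
  have hev : Function.Surjective ev := by
    rintro ⟨g, h⟩
    obtain ⟨u, rfl⟩ := P.surjective_eval g
    obtain ⟨v, rfl⟩ := P'.surjective_eval h
    exact ⟨i₁ u * i₂ v, by simp [ev, hp₁i₁, hp₁i₂, hp₂i₁, hp₂i₂]⟩
  let com : Fin P.rank × Fin P'.rank → FreeGroup (Fin P.rank ⊕ Fin P'.rank) := fun q =>
    i₂ (.of q.2) * i₁ (.of q.1) * (i₂ (.of q.2))⁻¹ * (i₁ (.of q.1))⁻¹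
  let R : Set (FreeGroup (Fin P.rank ⊕ Fin P'.rank)) :=
    i₁ '' P.rels ∪ i₂ '' P'.rels ∪ Set.range com
  have hR : R.Finite :=
    ((P.finite_rels.image _).union (P'.finite_rels.image _)).union (Set.finite_range _)
  have hRev : ∀ g ∈ R, ev g = 1 := by
    rintro _ ((⟨r, hr, rfl⟩ | ⟨r, hr, rfl⟩) | ⟨q, rfl⟩)
    · simp [ev, hp₁i₁, hp₂i₁, P.eval_eq_one_of_mem_rels hr]
    · simp [ev, hp₁i₂, hp₂i₂, P'.eval_eq_one_of_mem_rels hr]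
    · simp [ev, com, hp₁i₁, hp₁i₂, hp₂i₁, hp₂i₂]
  obtain ⟨c₁, hc₁⟩ := FreeGroup.exists_norm_map_le p₁
  obtain ⟨c₂, hc₂⟩ := FreeGroup.exists_norm_map_le p₂
  have hcomm : ∀ (y : Fin P'.rank) (b : Bool) (g : FreeGroup (Fin P.rank)),
      Near R g.norm (i₂ (.mk [(y, b)]) * i₁ g) (i₁ g * i₂ (.mk [(y, b)])) := by
    intro y b g
    have hx : ∀ x, Near R 1 (MulAut.conj (i₂ (.of y)) (i₁ (.of x))) (i₁ (.of x)) := fun x => by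
      rw [MulAut.conj_apply]
      exact FillsIn.of_mem (Or.inr ⟨(x, y), rfl⟩)
    -- Conjugation by one letter of `H` is a homomorphism that nearly agrees with the inclusion of
    -- the first factor on generators, hence with linear error on all words.
    have hg : Near R (1 * g.norm) (MulAut.conj (i₂ (.of y)) (i₁ g)) (i₁ g) :=
      FreeGroup.near_of_near_of (θ := (MulAut.conj (i₂ (.of y))).toMonoidHom.comp i₁) hx g
    rw [MulAut.conj_apply, one_mul] at hg
    cases b
    · have : (.mk [(y, false)] : FreeGroup (Fin P'.rank)) = (.of y)⁻¹ := rfl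
      rw [this, map_inv]
      simpa [mul_assoc] using (hg.mul_left (i₂ (.of y))⁻¹).symm
    · have := hg.mul_right (i₂ (.of y))
      rwa [inv_mul_cancel_right] at this
  -- Sorting letters: a prepended letter of `H` crosses a word over `G` of linear length, so the
  -- total cost is quadratic.
  have hsplit : ∀ w, Near R (c₁ * w.length ^ 2) (FreeGroup.mk w)
      (i₁ (p₁ (.mk w)) * i₂ (p₂ (.mk w))) := by
    intro w
    induction w with
    | nil => simpa [← FreeGroup.one_eq_mk] using Near.refl R 1
    | cons q w ih =>
      obtain ⟨t, b⟩ := q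
      have hcons : (.mk ((t, b) :: w) : FreeGroup (Fin P.rank ⊕ Fin P'.rank)) =
        .mk [(t, b)] * .mk w := rfl
      rw [hcons, map_mul, map_mul, map_mul, map_mul]
      rcases t with x | y
      · have h0 : (.mk [(Sum.inl x, b)] : FreeGroup (Fin P.rank ⊕ Fin P'.rank)) =
          i₁ (.mk [(x, b)]) := rfl
        rw [h0, hp₁i₁, hp₂i₁, map_one, one_mul, mul_assoc]
        refine (ih.mul_left _).mono (Nat.mul_le_mul_left _ ?_)
        simp only [List.length_cons]
        gcongr
        omega
      · have h0 : (.mk [(Sum.inr y, b)] : FreeGroup (Fin P.rank ⊕ Fin P'.rank)) =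
          i₂ (.mk [(y, b)]) := rfl
        rw [h0, hp₁i₂, hp₂i₂, map_one, one_mul]
        have h1 := (hcomm y b (p₁ (.mk w))).mul_right (i₂ (p₂ (.mk w)))
        rw [mul_assoc, mul_assoc] at h1
        refine ((ih.mul_left _).trans h1).mono ?_
        have h2 := (hc₁ (.mk w)).trans (Nat.mul_le_mul_left c₁ FreeGroup.norm_mk_le)
        simp only [List.length_cons]
        nlinarith
  have hfill : ∀ g, ev g = 1 →
      FillsIn R (P.dehn (c₁ * g.norm) + P'.dehn (c₂ * g.norm) + c₁ * g.norm ^ 2) g := by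
    intro g hg
    have hg' : P.eval (p₁ g) = 1 ∧ P'.eval (p₂ g) = 1 := by
      simpa [ev, Prod.ext_iff] using hg
    have h1 := (P.fillsIn_dehn hg'.1 (hc₁ g)).map (R' := R) (c := 1) i₁
      fun r hr => FillsIn.of_mem (Or.inl (Or.inl ⟨r, hr, rfl⟩))
    have h2 := (P'.fillsIn_dehn hg'.2 (hc₂ g)).map (R' := R) (c := 1) i₂
      fun r hr => FillsIn.of_mem (Or.inl (Or.inr ⟨r, hr, rfl⟩))
    have h3 := hsplit g.toWord
    rw [FreeGroup.mk_toWord] at h3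
    have h4 := h1.mul h2
    rw [← Near.one_right_iff] at h4 ⊢
    refine (h3.trans h4).mono ?_
    rw [one_mul, one_mul, add_comm]
    rfl
  refine ⟨Group.isFinitelyPresented_of_fillsIn hev hR hRev fun g hg => ⟨_, hfill g hg⟩,
    fun S => ?_⟩
  obtain ⟨C, -, hC⟩ := S.exists_dehn_le_of_retract (MonoidHom.id _) (MonoidHom.id _) (fun _ => rfl)
    hev hR hRev
    (B := fun n => P.dehn (c₁ * n) + P'.dehn (c₂ * n) + c₁ * n ^ 2)
    (fun n k hnk => by
      have h1 := P.dehn_mono (Nat.mul_le_mul_left c₁ hnk)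
      have h2 := P'.dehn_mono (Nat.mul_le_mul_left c₂ hnk)
      have h3 := Nat.mul_le_mul_left c₁ (Nat.pow_le_pow_left hnk 2)
      dsimp only
      omega) hfill
  refine ⟨C + c₁ * C + c₂ * C + C * c₁ * C ^ 2, fun n => (hC n).trans ?_⟩
  set D := C + c₁ * C + c₂ * C + C * c₁ * C ^ 2 with hD
  have h1 : P.dehn (c₁ * (C * n)) ≤ P.dehn (D * n) := P.dehn_mono (by
    rw [← mul_assoc]; exact Nat.mul_le_mul_right n (by rw [hD]; omega))
  have h2 : P'.dehn (c₂ * (C * n)) ≤ P'.dehn (D * n) := P'.dehn_mono (by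
    rw [← mul_assoc]; exact Nat.mul_le_mul_right n (by rw [hD]; omega))
  have h3 : C * P.dehn (c₁ * (C * n)) ≤ D * P.dehn (D * n) :=
    Nat.mul_le_mul (by rw [hD]; omega) h1
  have h4 : C * P'.dehn (c₂ * (C * n)) ≤ D * P'.dehn (D * n) :=
    Nat.mul_le_mul (by rw [hD]; omega) h2
  -- The linear error from changing presentations disappears in the quadratic term.
  have h5 : C * n ≤ C * n ^ 2 := Nat.mul_le_mul_left C (Nat.le_self_pow (by norm_num) n)
  have h6 : (C + C * c₁ * C ^ 2) * n ^ 2 ≤ D * n ^ 2 :=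
    Nat.mul_le_mul_right _ (by rw [hD]; omega)
  nlinarith

end Prod

end FinitePresentation

/-! ### Groups glued from three products: normal forms and dyadic subdivision. -/

namespace FinitePresentation

variable {G α : Type*} [Group G] (P : FinitePresentation G)

/-- A lift of a homomorphism from a free group to the free group of a presentation. -/
noncomputable def lift (θ : FreeGroup α →* G) : FreeGroup α →* FreeGroup (Fin P.rank) :=
  (FreeGroup.exists_lift_of_surjective P.surjective_eval θ).choose

@[simp]
theorem eval_lift (θ : FreeGroup α →* G) (g : FreeGroup α) : P.eval (P.lift θ g) = θ g :=
  (FreeGroup.exists_lift_of_surjective P.surjective_eval θ).choose_spec g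

end FinitePresentation

/-- A group `K` that is covered by three subgroups isomorphic to `A × B`, `A × C` and `B × C`, which
are glued along copies of `A`, `B` and `C`. Every element of `K` is a product of an element of
`A × B` and an element of the kernel of `t₃₁ : C → A`. -/
structure ProductTriangle (A B C K : Type*) [Group A] [Group B] [Group C] [Group K] where
  /-- a presentation of `A` -/
  P₁ : FinitePresentation A
  /-- a presentation of `B` -/
  P₂ : FinitePresentation B
  /-- a presentation of `C` -/
  P₃ : FinitePresentation C
  /-- a presentation of `A × B` -/
  P₁₂ : FinitePresentation (A × B)
  /-- a presentation of `A × C` -/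
  P₁₃ : FinitePresentation (A × C)
  /-- a presentation of `B × C` -/
  P₂₃ : FinitePresentation (B × C)
  /-- the inclusion of `A × B` -/
  j₁₂ : A × B →* K
  /-- the inclusion of `A × C` -/
  j₁₃ : A × C →* K
  /-- the inclusion of `B × C` -/
  j₂₃ : B × C →* K
  /-- the second coordinate in `A × C` of an element of `A ⊆ A × B` -/
  t₁₃ : A →* C
  /-- the second coordinate in `B × C` of an element of `B ⊆ A × B` -/
  t₂₃ : B →* C
  /-- the first coordinate in `A × C` of an element of `C ⊆ B × C` -/
  t₃₁ : C →* A
  /-- the projection to `A × B` -/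
  π : K →* A × B
  /-- the first factor of the projection to the kernel of `t₃₁` -/
  σ : K →* C
  /-- the second factor of the projection to the kernel of `t₃₁` -/
  ρ : K →* C
  j₁₂_left : ∀ a, j₁₂ (a, 1) = j₁₃ (a, t₁₃ a)
  j₁₂_right : ∀ b, j₁₂ (1, b) = j₂₃ (b, t₂₃ b)
  j₂₃_right : ∀ c, j₂₃ (1, c) = j₁₃ (t₃₁ c, c)
  j₁₃_injective : Function.Injective j₁₃
  decomposition : ∀ k, j₁₂ (π k) * j₁₃ (1, σ k * ρ k) = k
  t₃₁_eq_one : ∀ k, t₃₁ (σ k * ρ k) = 1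

/-- The solution of the recursion `S (k + 1) = 2 * S k + c * D (c * 2 ^ k) + c * 2 ^ k`. -/
def dyadicSum (D : ℕ → ℕ) (c : ℕ) : ℕ → ℕ
  | 0 => 1
  | k + 1 => 2 * dyadicSum D c k + (c * D (c * 2 ^ k) + c * 2 ^ k)

theorem dyadicSum_mono (D : ℕ → ℕ) (c : ℕ) : Monotone (dyadicSum D c) :=
  monotone_nat_of_le_succ fun k => by
    rw [dyadicSum]
    omega

namespace ProductTriangle

variable {A B C K : Type*} [Group A] [Group B] [Group C] [Group K] (T : ProductTriangle A B C K)

/-- The index set of the generators of `K`. -/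
abbrev Gen : Type := Fin T.P₁₂.rank ⊕ Fin T.P₁₃.rank ⊕ Fin T.P₂₃.rank

/-- The inclusion of the free group on the generators of `A × B`. -/
def J₁₂ : FreeGroup (Fin T.P₁₂.rank) →* FreeGroup T.Gen := FreeGroup.map Sum.inl

/-- The inclusion of the free group on the generators of `A × C`. -/
def J₁₃ : FreeGroup (Fin T.P₁₃.rank) →* FreeGroup T.Gen := FreeGroup.map (Sum.inr ∘ Sum.inl)

/-- The inclusion of the free group on the generators of `B × C`. -/
def J₂₃ : FreeGroup (Fin T.P₂₃.rank) →* FreeGroup T.Gen := FreeGroup.map (Sum.inr ∘ Sum.inr)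

/-- The evaluation of words in `K`. -/
def ev : FreeGroup T.Gen →* K :=
  FreeGroup.lift (Sum.elim (fun x => T.j₁₂ (T.P₁₂.eval (.of x)))
    (Sum.elim (fun x => T.j₁₃ (T.P₁₃.eval (.of x))) fun x => T.j₂₃ (T.P₂₃.eval (.of x))))

@[simp]
theorem ev_J₁₂ (g : FreeGroup (Fin T.P₁₂.rank)) : T.ev (T.J₁₂ g) = T.j₁₂ (T.P₁₂.eval g) := by
  have : T.ev.comp T.J₁₂ = T.j₁₂.comp T.P₁₂.eval := by ext; simp [ev, J₁₂]
  exact DFunLike.congr_fun this g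

@[simp]
theorem ev_J₁₃ (g : FreeGroup (Fin T.P₁₃.rank)) : T.ev (T.J₁₃ g) = T.j₁₃ (T.P₁₃.eval g) := by
  have : T.ev.comp T.J₁₃ = T.j₁₃.comp T.P₁₃.eval := by ext; simp [ev, J₁₃]
  exact DFunLike.congr_fun this g

@[simp]
theorem ev_J₂₃ (g : FreeGroup (Fin T.P₂₃.rank)) : T.ev (T.J₂₃ g) = T.j₂₃ (T.P₂₃.eval g) := by
  have : T.ev.comp T.J₂₃ = T.j₂₃.comp T.P₂₃.eval := by ext; simp [ev, J₂₃]
  exact DFunLike.congr_fun this g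

/-- A lift of the inclusion of `A` into `A × B`. -/
noncomputable def left₁₂ := T.P₁₂.lift ((MonoidHom.inl A B).comp T.P₁.eval)

/-- A lift of the inclusion of `B` into `A × B`. -/
noncomputable def right₁₂ := T.P₁₂.lift ((MonoidHom.inr A B).comp T.P₂.eval)

/-- A lift of the map from `A` to `A × C`. -/
noncomputable def graph₁₃ := T.P₁₃.lift (((MonoidHom.id A).prod T.t₁₃).comp T.P₁.eval)

/-- A lift of the map from `B` to `B × C`. -/
noncomputable def graph₂₃ := T.P₂₃.lift (((MonoidHom.id B).prod T.t₂₃).comp T.P₂.eval)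

/-- A lift of the inclusion of `C` into `B × C`. -/
noncomputable def right₂₃ := T.P₂₃.lift ((MonoidHom.inr B C).comp T.P₃.eval)

/-- A lift of the map from `C` to `A × C`. -/
noncomputable def graph₃₁ := T.P₁₃.lift ((T.t₃₁.prod (MonoidHom.id C)).comp T.P₃.eval)

/-- The `A × B`-part of the normal form. -/
noncomputable def base : FreeGroup T.Gen →* FreeGroup (Fin T.P₁₂.rank) :=
  T.P₁₂.lift (T.π.comp T.ev)

/-- The part of the normal form that lies in the kernel of `t₃₁`. -/
noncomputable def fibre (g : FreeGroup T.Gen) : FreeGroup (Fin T.P₁₃.rank) :=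
  T.P₁₃.lift ((MonoidHom.inr A C).comp (T.σ.comp T.ev)) g *
    T.P₁₃.lift ((MonoidHom.inr A C).comp (T.ρ.comp T.ev)) g

/-- A normal form for the elements of `K`, as a function of words. -/
noncomputable def normalForm (g : FreeGroup T.Gen) : FreeGroup T.Gen :=
  T.J₁₂ (T.base g) * T.J₁₃ (T.fibre g)

theorem eval_base (g : FreeGroup T.Gen) : T.P₁₂.eval (T.base g) = T.π (T.ev g) := by
  simp [base]

theorem eval_fibre (g : FreeGroup T.Gen) :
    T.P₁₃.eval (T.fibre g) = (1, T.σ (T.ev g) * T.ρ (T.ev g)) := by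
  simp [fibre]

theorem ev_normalForm (g : FreeGroup T.Gen) : T.ev (T.normalForm g) = T.ev g := by
  rw [normalForm, map_mul, ev_J₁₂, ev_J₁₃, eval_base, eval_fibre, T.decomposition]

theorem ev_surjective : Function.Surjective T.ev := fun k => by
  obtain ⟨u, hu⟩ := T.P₁₂.surjective_eval (T.π k)
  obtain ⟨v, hv⟩ := T.P₁₃.surjective_eval (1, T.σ k * T.ρ k)
  exact ⟨T.J₁₂ u * T.J₁₃ v, by simp [hu, hv, T.decomposition]⟩

/-- The relators of `K` that identify the copies of `A`, `B` and `C` in the products and the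
letters with their normal forms. -/
def gluingRels : Set (FreeGroup T.Gen) :=
  (Set.range fun x => T.J₁₂ (T.left₁₂ (.of x)) * (T.J₁₃ (T.graph₁₃ (.of x)))⁻¹) ∪
  (Set.range fun x => T.J₁₂ (T.right₁₂ (.of x)) * (T.J₂₃ (T.graph₂₃ (.of x)))⁻¹) ∪
  (Set.range fun x => T.J₂₃ (T.right₂₃ (.of x)) * (T.J₁₃ (T.graph₃₁ (.of x)))⁻¹) ∪
  (Set.range fun q : T.Gen × Bool =>
    (FreeGroup.mk [q] : FreeGroup T.Gen) * (T.normalForm (FreeGroup.mk [q]))⁻¹)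

/-- The relators of `K`. -/
def rels : Set (FreeGroup T.Gen) :=
  T.J₁₂ '' T.P₁₂.rels ∪ T.J₁₃ '' T.P₁₃.rels ∪ T.J₂₃ '' T.P₂₃.rels ∪ T.gluingRels

theorem finite_rels : T.rels.Finite :=
  (((T.P₁₂.finite_rels.image _).union (T.P₁₃.finite_rels.image _)).union
    (T.P₂₃.finite_rels.image _)).union
    ((((Set.finite_range _).union (Set.finite_range _)).union (Set.finite_range _)).union
      (Set.finite_range _))

theorem ev_eq_one_of_mem_rels {r : FreeGroup T.Gen} (hr : r ∈ T.rels) : T.ev r = 1 := by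
  obtain ((⟨r, hr, rfl⟩ | ⟨r, hr, rfl⟩) | ⟨r, hr, rfl⟩) |
    (((⟨x, rfl⟩ | ⟨x, rfl⟩) | ⟨x, rfl⟩) | ⟨x, rfl⟩) := hr
  · simp [T.P₁₂.eval_eq_one_of_mem_rels hr]
  · simp [T.P₁₃.eval_eq_one_of_mem_rels hr]
  · simp [T.P₂₃.eval_eq_one_of_mem_rels hr]
  · simp [left₁₂, graph₁₃, T.j₁₂_left]
  · simp [right₁₂, graph₂₃, T.j₁₂_right]
  · simp [right₂₃, graph₃₁, T.j₂₃_right]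
  · simp [T.ev_normalForm]

/-- The sum of the Dehn functions of the three products. -/
noncomputable def dehnSum (n : ℕ) : ℕ := T.P₁₂.dehn n + T.P₁₃.dehn n + T.P₂₃.dehn n

theorem dehnSum_mono : Monotone T.dehnSum := fun _ _ h =>
  add_le_add (add_le_add (T.P₁₂.dehn_mono h) (T.P₁₃.dehn_mono h)) (T.P₂₃.dehn_mono h)

theorem near_J₁₂ {g h : FreeGroup (Fin T.P₁₂.rank)} (hgh : T.P₁₂.eval g = T.P₁₂.eval h) {n : ℕ}
    (hn : g.norm + h.norm ≤ n) : Near T.rels (T.dehnSum n) (T.J₁₂ g) (T.J₁₂ h) := by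
  refine ((T.P₁₂.near_dehn hgh hn).map (c := 1) T.J₁₂ fun r hr =>
    FillsIn.of_mem (Or.inl (Or.inl (Or.inl ⟨r, hr, rfl⟩)))).mono ?_
  rw [dehnSum]
  omega

theorem near_J₁₃ {g h : FreeGroup (Fin T.P₁₃.rank)} (hgh : T.P₁₃.eval g = T.P₁₃.eval h) {n : ℕ}
    (hn : g.norm + h.norm ≤ n) : Near T.rels (T.dehnSum n) (T.J₁₃ g) (T.J₁₃ h) := by
  refine ((T.P₁₃.near_dehn hgh hn).map (c := 1) T.J₁₃ fun r hr =>
    FillsIn.of_mem (Or.inl (Or.inl (Or.inr ⟨r, hr, rfl⟩)))).mono ?_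
  rw [dehnSum]
  omega

theorem near_J₂₃ {g h : FreeGroup (Fin T.P₂₃.rank)} (hgh : T.P₂₃.eval g = T.P₂₃.eval h) {n : ℕ}
    (hn : g.norm + h.norm ≤ n) : Near T.rels (T.dehnSum n) (T.J₂₃ g) (T.J₂₃ h) := by
  refine ((T.P₂₃.near_dehn hgh hn).map (c := 1) T.J₂₃ fun r hr =>
    FillsIn.of_mem (Or.inl (Or.inr ⟨r, hr, rfl⟩))).mono ?_
  rw [dehnSum]
  omega

/-- The two copies of `A` are identified by relators on generators; since both sides are
homomorphisms in `e`, the change of copy costs only linearly many relators. -/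
theorem near_left₁₂_graph₁₃ (e : FreeGroup (Fin T.P₁.rank)) :
    Near T.rels e.norm (T.J₁₂ (T.left₁₂ e)) (T.J₁₃ (T.graph₁₃ e)) := by
  simpa using FreeGroup.near_of_near_of (R := T.rels) (c := 1)
    (θ := T.J₁₂.comp T.left₁₂) (θ' := T.J₁₃.comp T.graph₁₃)
    (fun x => FillsIn.of_mem (Or.inr (Or.inl (Or.inl (Or.inl ⟨x, rfl⟩))))) e

theorem near_right₁₂_graph₂₃ (e : FreeGroup (Fin T.P₂.rank)) :
    Near T.rels e.norm (T.J₁₂ (T.right₁₂ e)) (T.J₂₃ (T.graph₂₃ e)) := by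
  simpa using FreeGroup.near_of_near_of (R := T.rels) (c := 1)
    (θ := T.J₁₂.comp T.right₁₂) (θ' := T.J₂₃.comp T.graph₂₃)
    (fun x => FillsIn.of_mem (Or.inr (Or.inl (Or.inl (Or.inr ⟨x, rfl⟩))))) e

theorem near_right₂₃_graph₃₁ (e : FreeGroup (Fin T.P₃.rank)) :
    Near T.rels e.norm (T.J₂₃ (T.right₂₃ e)) (T.J₁₃ (T.graph₃₁ e)) := by
  simpa using FreeGroup.near_of_near_of (R := T.rels) (c := 1)
    (θ := T.J₂₃.comp T.right₂₃) (θ' := T.J₁₃.comp T.graph₃₁)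
    (fun x => FillsIn.of_mem (Or.inr (Or.inl (Or.inr ⟨x, rfl⟩)))) e

theorem near_letter_normalForm (q : T.Gen × Bool) :
    Near T.rels 1 (FreeGroup.mk [q]) (T.normalForm (FreeGroup.mk [q])) :=
  FillsIn.of_mem (Or.inr (Or.inr ⟨q, rfl⟩))

/-- Elements of `A` can be moved across the kernel of `t₃₁` inside `A × C`. The result is
expressed in terms of `B × C`. -/
theorem exists_near_mul_left :
    ∃ c, ∀ n e v, FreeGroup.norm e ≤ n → FreeGroup.norm v ≤ n →
      (T.P₁₃.eval v).1 = 1 → T.t₃₁ (T.P₁₃.eval v).2 = 1 →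
      ∃ z, z.norm ≤ c * n ∧
        Near T.rels (T.dehnSum (c * n) + c * n) (T.J₁₃ v * T.J₁₂ (T.left₁₂ e))
          (T.J₁₂ (T.left₁₂ e) * T.J₂₃ (T.right₂₃ z)) := by
  obtain ⟨q, a, hq, ha⟩ := FreeGroup.exists_lipschitz_lift T.P₃.surjective_eval
    ((MonoidHom.snd A C).comp T.P₁₃.eval)
  obtain ⟨b, hb⟩ := FreeGroup.exists_norm_map_le T.graph₁₃
  obtain ⟨d, hd⟩ := FreeGroup.exists_norm_map_le T.graph₃₁
  refine ⟨(2 * b + 1) * (a * d + a + 1) + 2, fun n e v he hv hv₁ hv₂ => ?_⟩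
  set v' := (T.graph₁₃ e)⁻¹ * v * T.graph₁₃ e with hv'
  have hnorm : v'.norm ≤ (2 * b + 1) * n := by
    have h1 := FreeGroup.norm_mul_le ((T.graph₁₃ e)⁻¹ * v) (T.graph₁₃ e)
    have h2 := FreeGroup.norm_mul_le (T.graph₁₃ e)⁻¹ v
    rw [FreeGroup.norm_inv_eq] at h2
    have h3 := (hb e).trans (Nat.mul_le_mul_left b he)
    rw [← hv'] at h1
    linarith
  have hzn : (q v').norm ≤ a * ((2 * b + 1) * n) :=
    (ha v').trans (Nat.mul_le_mul_left a hnorm)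
  have hgn : (T.graph₃₁ (q v')).norm ≤ d * (a * ((2 * b + 1) * n)) :=
    (hd _).trans (Nat.mul_le_mul_left d hzn)
  -- In `A × C` the conjugate keeps trivial first coordinate, and its second coordinate stays in the
  -- normal subgroup `ker t₃₁`. There the graph of `t₃₁` has trivial `A`-coordinate, so the word may
  -- be rewritten through `graph₃₁`, which can be passed to `B × C`.
  have heval : T.P₁₃.eval v' = T.P₁₃.eval (T.graph₃₁ (q v')) := by
    ext
    · simp [graph₃₁, hq, hv', graph₁₃, hv₁, hv₂]
    · simp [graph₃₁, hq]
  refine ⟨q v', hzn.trans (by nlinarith [Nat.zero_le ((2 * b + 1) * n * (a * d + 1) + 2 * n)]), ?_⟩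
  have h1 := (T.near_left₁₂_graph₁₃ e).mul_left (T.J₁₃ v)
  have h2 : T.J₁₃ v * T.J₁₃ (T.graph₁₃ e) = T.J₁₃ (T.graph₁₃ e) * T.J₁₃ v' := by
    simp [hv', mul_assoc]
  rw [h2] at h1
  have h3 := T.near_J₁₃ heval (n := ((2 * b + 1) * (a * d + a + 1) + 2) * n) (by
    nlinarith [Nat.zero_le ((2 * b + 1) * n * a + 2 * n)])
  have h4 := h3.trans (T.near_right₂₃_graph₃₁ (q v')).symm
  refine (h1.trans ((T.near_left₁₂_graph₁₃ e).symm.mul h4)).mono ?_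
  nlinarith [Nat.zero_le ((2 * b + 1) * n * (a * d + 1))]

/-- Elements of `B` can be moved across the kernel of `t₃₁` inside `B × C`. The result is
expressed in terms of `A × C`. -/
theorem exists_near_mul_right :
    ∃ c, ∀ n e z, FreeGroup.norm e ≤ n → FreeGroup.norm z ≤ n →
      ∃ v, v.norm ≤ c * n ∧
        Near T.rels (T.dehnSum (c * n) + c * n) (T.J₂₃ (T.right₂₃ z) * T.J₁₂ (T.right₁₂ e))
          (T.J₁₂ (T.right₁₂ e) * T.J₁₃ v) := by
  obtain ⟨q, a, hq, ha⟩ := FreeGroup.exists_lipschitz_lift T.P₃.surjective_eval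
    ((MonoidHom.snd B C).comp T.P₂₃.eval)
  obtain ⟨b, hb⟩ := FreeGroup.exists_norm_map_le T.graph₂₃
  obtain ⟨d, hd⟩ := FreeGroup.exists_norm_map_le T.right₂₃
  obtain ⟨d', hd'⟩ := FreeGroup.exists_norm_map_le T.graph₃₁
  refine ⟨(2 * b + d) * (a * d + a * d' + a + 1) + 2, fun n e z he hz => ?_⟩
  set v' := (T.graph₂₃ e)⁻¹ * T.right₂₃ z * T.graph₂₃ e with hv'
  have hnorm : v'.norm ≤ (2 * b + d) * n := by
    have h1 := FreeGroup.norm_mul_le ((T.graph₂₃ e)⁻¹ * T.right₂₃ z) (T.graph₂₃ e)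
    have h2 := FreeGroup.norm_mul_le (T.graph₂₃ e)⁻¹ (T.right₂₃ z)
    rw [FreeGroup.norm_inv_eq] at h2
    have h3 := (hb e).trans (Nat.mul_le_mul_left b he)
    have h4 := (hd z).trans (Nat.mul_le_mul_left d hz)
    rw [← hv'] at h1
    linarith
  have hzn : (q v').norm ≤ a * ((2 * b + d) * n) :=
    (ha v').trans (Nat.mul_le_mul_left a hnorm)
  have hrn : (T.right₂₃ (q v')).norm ≤ d * (a * ((2 * b + d) * n)) :=
    (hd _).trans (Nat.mul_le_mul_left d hzn)
  have hgn : (T.graph₃₁ (q v')).norm ≤ d' * (a * ((2 * b + d) * n)) :=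
    (hd' _).trans (Nat.mul_le_mul_left d' hzn)
  -- The factor `1 × C` is normal in `B × C`, so no condition involving `t₃₁` is needed here.
  have heval : T.P₂₃.eval v' = T.P₂₃.eval (T.right₂₃ (q v')) := by
    ext
    · simp [right₂₃, hv', graph₂₃]
    · simp [right₂₃, hq]
  refine ⟨T.graph₃₁ (q v'), hgn.trans (by
    nlinarith [Nat.zero_le ((2 * b + d) * n * (a * d + a + 1) + 2 * n)]), ?_⟩
  have h1 := (T.near_right₁₂_graph₂₃ e).mul_left (T.J₂₃ (T.right₂₃ z))
  have h2 : T.J₂₃ (T.right₂₃ z) * T.J₂₃ (T.graph₂₃ e) = T.J₂₃ (T.graph₂₃ e) * T.J₂₃ v' := by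
    simp [hv', mul_assoc]
  rw [h2] at h1
  have h3 := T.near_J₂₃ heval (n := ((2 * b + d) * (a * d + a * d' + a + 1) + 2) * n) (by
    nlinarith [Nat.zero_le ((2 * b + d) * n * (a * d' + a) + 2 * n)])
  have h4 := h3.trans (T.near_right₂₃_graph₃₁ (q v'))
  refine (h1.trans ((T.near_right₁₂_graph₂₃ e).symm.mul h4)).mono ?_
  nlinarith [Nat.zero_le ((2 * b + d) * n * (a * d + a * d' + 1))]

/-- Elements of `A × B` can be moved across the kernel of `t₃₁`. -/
theorem exists_near_mul :
    ∃ c, ∀ n u v, FreeGroup.norm u ≤ n → FreeGroup.norm v ≤ n →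
      (T.P₁₃.eval v).1 = 1 → T.t₃₁ (T.P₁₃.eval v).2 = 1 →
      ∃ v', v'.norm ≤ c * n ∧
        Near T.rels (c * T.dehnSum (c * n) + c * n) (T.J₁₃ v * T.J₁₂ u)
          (T.J₁₂ u * T.J₁₃ v') := by
  obtain ⟨p₁, a₁, hp₁, ha₁⟩ := FreeGroup.exists_lipschitz_lift T.P₁.surjective_eval
    ((MonoidHom.fst A B).comp T.P₁₂.eval)
  obtain ⟨p₂, a₂, hp₂, ha₂⟩ := FreeGroup.exists_lipschitz_lift T.P₂.surjective_eval
    ((MonoidHom.snd A B).comp T.P₁₂.eval)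
  obtain ⟨b₁, hb₁⟩ := FreeGroup.exists_norm_map_le T.left₁₂
  obtain ⟨b₂, hb₂⟩ := FreeGroup.exists_norm_map_le T.right₁₂
  obtain ⟨c₁, hc₁⟩ := T.exists_near_mul_left
  obtain ⟨c₂, hc₂⟩ := T.exists_near_mul_right
  obtain ⟨M, hM⟩ : ∃ M, M = a₁ + a₂ + 1 := ⟨_, rfl⟩
  obtain ⟨N, hN⟩ : ∃ N, N = (c₁ + 1) * M := ⟨_, rfl⟩
  obtain ⟨c, hc⟩ : ∃ c, c = N + c₁ * M + c₂ * N + (1 + b₁ * M + b₂ * M) + 4 := ⟨_, rfl⟩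
  refine ⟨c, fun n u v hu hv hv₁ hv₂ => ?_⟩
  have hM1 : a₁ * n ≤ M * n := Nat.mul_le_mul_right n (by omega)
  have hM2 : a₂ * n ≤ M * n := Nat.mul_le_mul_right n (by omega)
  have hM3 : 1 * n ≤ M * n := Nat.mul_le_mul_right n (by omega)
  have he₁ : (p₁ u).norm ≤ M * n := (ha₁ u).trans ((Nat.mul_le_mul_left a₁ hu).trans hM1)
  have he₂ : (p₂ u).norm ≤ M * n := (ha₂ u).trans ((Nat.mul_le_mul_left a₂ hu).trans hM2)
  obtain ⟨z, hz, hnz⟩ := hc₁ (M * n) (p₁ u) v he₁ (by omega) hv₁ hv₂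
  obtain ⟨v', hv', hnv'⟩ := hc₂ (N * n) (p₂ u) z
    (he₂.trans (by rw [hN]; nlinarith [Nat.zero_le (c₁ * M * n)]))
    (hz.trans (by rw [hN]; nlinarith [Nat.zero_le (M * n)]))
  have hsplit : Near T.rels (T.dehnSum (c * n)) (T.J₁₂ u)
      (T.J₁₂ (T.left₁₂ (p₁ u)) * T.J₁₂ (T.right₁₂ (p₂ u))) := by
    rw [← map_mul]
    refine T.near_J₁₂ ?_ ?_
    · ext <;> simp [left₁₂, right₁₂, hp₁, hp₂]
    · have h1 := FreeGroup.norm_mul_le (T.left₁₂ (p₁ u)) (T.right₁₂ (p₂ u))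
      have h2 := (hb₁ (p₁ u)).trans (Nat.mul_le_mul_left b₁ he₁)
      have h3 := (hb₂ (p₂ u)).trans (Nat.mul_le_mul_left b₂ he₂)
      have h4 : (1 + b₁ * M + b₂ * M) * n ≤ c * n := Nat.mul_le_mul_right n (by omega)
      nlinarith
  have hle₁ : c₁ * (M * n) ≤ c * n := by
    rw [← mul_assoc]; exact Nat.mul_le_mul_right n (by omega)
  have hle₂ : c₂ * (N * n) ≤ c * n := by
    rw [← mul_assoc]; exact Nat.mul_le_mul_right n (by omega)
  refine ⟨v', hv'.trans hle₂, ?_⟩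
  -- Four moves: split `u` into its `A`- and `B`-parts, cross the `A`-part inside `A × C`, cross the
  -- `B`-part inside `B × C`, reassemble `u`. Each costs at most one `dehnSum` plus a linear term,
  -- whence the summand `4` in `c`.
  have h1 := hsplit.mul_left (T.J₁₃ v)
  have h2 := hnz.mul_right (T.J₁₂ (T.right₁₂ (p₂ u)))
  have h3 := hnv'.mul_left (T.J₁₂ (T.left₁₂ (p₁ u)))
  have h4 := hsplit.symm.mul_right (T.J₁₃ v')
  simp only [mul_assoc] at h1 h2 h3 h4
  refine (((h1.trans h2).trans h3).trans h4).mono ?_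
  have h5 := T.dehnSum_mono hle₁
  have h6 := T.dehnSum_mono hle₂
  have h7 : 4 * T.dehnSum (c * n) ≤ c * T.dehnSum (c * n) := Nat.mul_le_mul_right _ (by omega)
  have h8 : (c₁ * M + c₂ * N) * n ≤ c * n := Nat.mul_le_mul_right n (by omega)
  nlinarith

/-- `fibre` is not a homomorphism, but it is a product of two, which is enough for a Lipschitz
bound; this is why `σ` and `ρ` are kept apart. -/
theorem exists_norm_base_fibre_le :
    ∃ c, ∀ g, (T.base g).norm ≤ c * g.norm ∧ (T.fibre g).norm ≤ c * g.norm := by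
  obtain ⟨a, ha⟩ := FreeGroup.exists_norm_map_le T.base
  obtain ⟨b, hb⟩ := FreeGroup.exists_norm_map_le
    (T.P₁₃.lift ((MonoidHom.inr A C).comp (T.σ.comp T.ev)))
  obtain ⟨d, hd⟩ := FreeGroup.exists_norm_map_le
    (T.P₁₃.lift ((MonoidHom.inr A C).comp (T.ρ.comp T.ev)))
  refine ⟨a + b + d, fun g => ⟨(ha g).trans (Nat.mul_le_mul_right _ (by omega)), ?_⟩⟩
  have := (FreeGroup.norm_mul_le _ _).trans (add_le_add (hb g) (hd g))
  refine this.trans ?_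
  rw [← add_mul]
  exact Nat.mul_le_mul_right _ (by omega)

/-- Normal forms are multiplicative up to fillings that the three products provide. -/
theorem exists_near_normalForm_mul :
    ∃ c, ∀ n g h, g.norm ≤ n → h.norm ≤ n →
      Near T.rels (c * T.dehnSum (c * n) + c * n) (T.normalForm g * T.normalForm h)
        (T.normalForm (g * h)) := by
  obtain ⟨a, ha⟩ := T.exists_norm_base_fibre_le
  obtain ⟨b, hb⟩ := T.exists_near_mul
  obtain ⟨c, hc⟩ : ∃ c, c = b * a + 3 * a + b + 1 := ⟨_, rfl⟩
  refine ⟨c, fun n g h hg hh => ?_⟩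
  have hgn := (ha g).2.trans (Nat.mul_le_mul_left a hg)
  have hhn := (ha h).1.trans (Nat.mul_le_mul_left a hh)
  obtain ⟨v, hv, hnv⟩ := hb (a * n) (T.base h) (T.fibre g) hhn hgn
    (by rw [eval_fibre]) (by rw [eval_fibre]; exact T.t₃₁_eq_one _)
  have h1 := (hnv.mul_left (T.J₁₂ (T.base g))).mul_right (T.J₁₃ (T.fibre h))
  have hl : T.J₁₂ (T.base g) * (T.J₁₃ (T.fibre g) * T.J₁₂ (T.base h)) * T.J₁₃ (T.fibre h) =
      T.normalForm g * T.normalForm h := by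
    simp only [normalForm, mul_assoc]
  have hr : T.J₁₂ (T.base g) * (T.J₁₂ (T.base h) * T.J₁₃ v) * T.J₁₃ (T.fibre h) =
      T.J₁₂ (T.base (g * h)) * T.J₁₃ (v * T.fibre h) := by
    simp only [map_mul, mul_assoc]
  rw [hl, hr] at h1
  -- Nothing is known about `v` beyond its length and the filling. As relators hold in `K`,
  -- evaluating there and cancelling the common base leaves an equality in the embedded copy of `A ×
  -- C`.
  have heval : T.P₁₃.eval (v * T.fibre h) = T.P₁₃.eval (T.fibre (g * h)) := by
    have h2 := h1.map_eq T.ev fun r hr => T.ev_eq_one_of_mem_rels hr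
    rw [map_mul, ev_normalForm, ev_normalForm, ← map_mul, ← T.ev_normalForm (g * h), normalForm,
      map_mul T.ev, map_mul T.ev, mul_right_inj, ev_J₁₃, ev_J₁₃] at h2
    exact (T.j₁₃_injective h2).symm
  have hle : b * (a * n) ≤ c * n := by
    rw [← mul_assoc]; exact Nat.mul_le_mul_right n (by omega)
  have h3 : Near T.rels (T.dehnSum (c * n)) (T.J₁₃ (v * T.fibre h)) (T.J₁₃ (T.fibre (g * h))) := by
    refine T.near_J₁₃ heval ?_
    have h4 := FreeGroup.norm_mul_le v (T.fibre h)
    have h5 := (ha h).2.trans (Nat.mul_le_mul_left a hh)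
    have h6 := (ha (g * h)).2.trans (Nat.mul_le_mul_left a (FreeGroup.norm_mul_le g h))
    have h7 := Nat.mul_le_mul_left a (add_le_add hg hh)
    have h8 : (b * a + 3 * a) * n ≤ c * n := Nat.mul_le_mul_right n (by omega)
    nlinarith
  refine (h1.trans (h3.mul_left (T.J₁₂ (T.base (g * h))))).mono ?_
  have h4 := T.dehnSum_mono hle
  have h5 : b * T.dehnSum (b * (a * n)) ≤ b * T.dehnSum (c * n) := Nat.mul_le_mul_left b h4
  have h6 : (b + 1) * T.dehnSum (c * n) ≤ c * T.dehnSum (c * n) :=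
    Nat.mul_le_mul_right _ (by omega)
  nlinarith

theorem normalForm_one : T.normalForm 1 = 1 := by
  simp [normalForm, fibre]

/-- Dyadic subdivision: every word is close to its normal form. -/
theorem exists_near_normalForm :
    ∃ c, ∀ k g, g.norm ≤ 2 ^ k → Near T.rels (dyadicSum T.dehnSum c k) g (T.normalForm g) := by
  obtain ⟨c, hc⟩ := T.exists_near_normalForm_mul
  refine ⟨c, fun k => ?_⟩
  induction k with
  | zero =>
    intro g hg
    rw [pow_zero, FreeGroup.norm] at hg
    rw [← g.mk_toWord]
    match g.toWord, hg with
    | [], _ =>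
      rw [← FreeGroup.one_eq_mk, normalForm_one]
      exact (Near.refl _ _).mono (Nat.zero_le _)
    -- The relators for letters include inverse letters, since `normalForm` need not respect
    -- inverses.
    | [q], _ => exact T.near_letter_normalForm q
  | succ k ih =>
    intro g hg
    set g₁ : FreeGroup T.Gen := FreeGroup.mk (g.toWord.take (2 ^ k)) with hg₁
    set g₂ : FreeGroup T.Gen := FreeGroup.mk (g.toWord.drop (2 ^ k)) with hg₂
    have hgg : g₁ * g₂ = g := by
      rw [hg₁, hg₂, FreeGroup.mul_mk, List.take_append_drop, FreeGroup.mk_toWord]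
    have hn₁ : g₁.norm ≤ 2 ^ k := FreeGroup.norm_mk_le.trans (by simp)
    have hn₂ : g₂.norm ≤ 2 ^ k := FreeGroup.norm_mk_le.trans (by
      rw [FreeGroup.norm, pow_succ] at hg
      rw [List.length_drop]
      omega)
    have h := ((ih g₁ hn₁).mul (ih g₂ hn₂)).trans (hc (2 ^ k) g₁ g₂ hn₁ hn₂)
    rw [hgg] at h
    exact h.mono (by rw [dyadicSum]; omega)

/-- After dyadic reduction to the normal form of a null word, its base and fibre are separately null
in `A × B` and `A × C`, and each is filled there; this gives the last term. -/
theorem exists_fillsIn :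
    ∃ c, 0 < c ∧ ∀ g, T.ev g = 1 →
      FillsIn T.rels (dyadicSum T.dehnSum c (Nat.clog 2 g.norm) + 2 * T.dehnSum (c * g.norm)) g := by
  obtain ⟨c, hc⟩ := T.exists_near_normalForm
  obtain ⟨a, ha⟩ := T.exists_norm_base_fibre_le
  -- Enlarges `c` so that one constant serves both the recursion and the final fillings.
  have hmono : ∀ k, dyadicSum T.dehnSum c k ≤ dyadicSum T.dehnSum (c + a + 1) k := fun k => by
    induction k with
    | zero => rfl
    | succ k ih =>
      have h1 : c * 2 ^ k ≤ (c + a + 1) * 2 ^ k := Nat.mul_le_mul_right _ (by omega)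
      have h2 := Nat.mul_le_mul (show c ≤ c + a + 1 by omega) (T.dehnSum_mono h1)
      rw [dyadicSum, dyadicSum]
      omega
  refine ⟨c + a + 1, by omega, fun g hg => ?_⟩
  have h1 := hc (Nat.clog 2 g.norm) g (Nat.le_pow_clog (by norm_num) _)
  have hle : a * g.norm ≤ (c + a + 1) * g.norm := Nat.mul_le_mul_right _ (by omega)
  have h2 : Near T.rels (T.dehnSum ((c + a + 1) * g.norm)) (T.J₁₂ (T.base g)) (T.J₁₂ 1) :=
    T.near_J₁₂ (by simp [eval_base, hg]) (by simpa using (ha g).1.trans hle)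
  have h3 : Near T.rels (T.dehnSum ((c + a + 1) * g.norm)) (T.J₁₃ (T.fibre g)) (T.J₁₃ 1) :=
    T.near_J₁₃ (by simp [eval_fibre, hg]) (by simpa using (ha g).2.trans hle)
  have h4 := h1.trans (h2.mul h3)
  rw [map_one, map_one, mul_one, Near.one_right_iff] at h4
  refine h4.mono ?_
  have := hmono (Nat.clog 2 g.norm)
  omega

theorem isFinitelyPresented (T : ProductTriangle A B C K) : Group.IsFinitelyPresented K := by
  obtain ⟨c, -, hc⟩ := T.exists_fillsIn
  exact Group.isFinitelyPresented_of_fillsIn T.ev_surjective T.finite_rels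
    (fun _ => T.ev_eq_one_of_mem_rels) fun g hg => ⟨_, hc g hg⟩

theorem exists_dehn_le (Q : FinitePresentation K) :
    ∃ c C, 0 < c ∧ 0 < C ∧ ∀ n, Q.dehn n ≤
      C * (dyadicSum T.dehnSum c (Nat.clog 2 (C * n)) + 2 * T.dehnSum (c * (C * n))) + C * n := by
  obtain ⟨c, hc₀, hc⟩ := T.exists_fillsIn
  obtain ⟨C, hC₀, hC⟩ := Q.exists_dehn_le_of_retract (MonoidHom.id K) (MonoidHom.id K) (fun _ => rfl)
    T.ev_surjective T.finite_rels (fun _ => T.ev_eq_one_of_mem_rels)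
    (B := fun n => dyadicSum T.dehnSum c (Nat.clog 2 n) + 2 * T.dehnSum (c * n))
    (fun n k hnk => add_le_add (dyadicSum_mono _ _ (Nat.clog_mono_right 2 hnk))
      (Nat.mul_le_mul_left 2 (T.dehnSum_mono (Nat.mul_le_mul_left c hnk)))) hc
  exact ⟨c, C, hc₀, hC₀, hC⟩

end ProductTriangle

/-! ### Asymptotic comparison and the dyadic recursion. -/

section Asymptotics

variable {f g h : ℕ → ℝ}

theorem AsympLE.trans (hfg : AsympLE f g) (hgh : AsympLE g h) (h₀ : ∀ n, 0 < n → 0 ≤ h n)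
    (hmono : ∀ n k, 0 < n → n ≤ k → h n ≤ h k) : AsympLE f h := by
  obtain ⟨C, hC, hfg⟩ := hfg
  obtain ⟨D, hD, hgh⟩ := hgh
  obtain ⟨E, hE⟩ : ∃ E, E = C * C * D + C * D + C := ⟨_, rfl⟩
  have hE₀ : 0 < E := by rw [hE]; positivity
  refine ⟨E, hE₀, fun n hn => (hfg n hn).trans ?_⟩
  have h2 := hgh (C * n + C) (by positivity)
  have hle : D * (C * n + C) + D ≤ E * n + E := by
    have h1 : C * D * n ≤ E * n := Nat.mul_le_mul_right n (by omega)
    have h2 : 1 * D ≤ C * C * D := Nat.mul_le_mul_right D (by nlinarith)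
    nlinarith
  have h3 := hmono _ _ (by positivity) hle
  have hX₀ : 0 ≤ h (E * n + E) := h₀ _ (by positivity)
  set X := h (E * n + E)
  have h4 : g (C * n + C) ≤ D * X + D * (C * n + C) + D := by
    have := mul_le_mul_of_nonneg_left h3 (Nat.cast_nonneg (α := ℝ) D)
    push_cast at h2
    linarith
  have h5 := mul_le_mul_of_nonneg_left h4 (Nat.cast_nonneg (α := ℝ) C)
  have h6 : (0 : ℝ) ≤ (C * C * D + C) * X + C * D * n := by positivity
  have hE' : (E : ℝ) = C * C * D + C * D + C := by exact_mod_cast hE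
  rw [hE']
  linarith

theorem asympLE_of_le {a b : ℕ → ℕ} (hb : Monotone b) {C : ℕ} (hC : 0 < C)
    (hab : ∀ n, a n ≤ C * b (C * n) + C * n) :
    AsympLE (fun n => (a n : ℝ)) (fun n => (b n : ℝ)) := by
  refine ⟨C, hC, fun n _ => ?_⟩
  have h1 : a n ≤ C * b (C * n + C) + C * n + C := by
    have := Nat.mul_le_mul_left C (hb (Nat.le_add_right (C * n) C))
    have := hab n
    omega
  dsimp only
  exact_mod_cast h1

theorem le_superadditiveClosure (f : ℕ → ℝ) {n : ℕ} (hn : 0 < n) : f n ≤ superadditiveClosure f n :=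
  (superadditiveClosure_mem f).2 n hn

theorem superadditiveClosure_nonneg (hf₀ : ∀ n, 0 < n → 0 ≤ f n) {n : ℕ} (hn : 0 < n) :
    0 ≤ superadditiveClosure f n :=
  (hf₀ n hn).trans (le_superadditiveClosure f hn)

theorem superadditiveClosure_mono (hf₀ : ∀ n, 0 < n → 0 ≤ f n) {n k : ℕ} (hn : 0 < n)
    (hnk : n ≤ k) : superadditiveClosure f n ≤ superadditiveClosure f k := by
  rcases hnk.eq_or_lt with rfl | hlt
  · rfl
  · have h1 := (superadditiveClosure_mem f).1 n (k - n) hn (by omega)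
    have h2 := superadditiveClosure_nonneg hf₀ (n := k - n) (by omega)
    rw [Nat.add_sub_of_le hnk] at h1
    linarith

/-- Makes the factor `log` harmless: `AsympLE` evaluates at `C * n + C`, which is at least `2`, so
the zero of `log` at `1` never occurs. -/
theorem one_half_le_log {x : ℝ} (hx : 2 ≤ x) : 1 / 2 ≤ Real.log x := by
  have h1 := Real.log_two_gt_d9
  have h2 := Real.log_le_log (by norm_num) hx
  linarith

theorem AsympLE.superadditiveClosure_mul_log (hf₀ : ∀ n, 0 < n → 0 ≤ f n) (h : AsympLE g f) :
    AsympLE g (fun n => superadditiveClosure f n * Real.log n) := by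
  obtain ⟨C, hC, h⟩ := h
  refine ⟨2 * C, by positivity, fun n hn => (h n hn).trans ?_⟩
  have hle : C * n + C ≤ 2 * C * n + 2 * C := by nlinarith
  have h1 := le_superadditiveClosure f (n := C * n + C) (by positivity)
  have h2 := superadditiveClosure_mono hf₀ (by positivity) hle
  set X := superadditiveClosure f (2 * C * n + 2 * C)
  have hX : 0 ≤ X := superadditiveClosure_nonneg hf₀ (by positivity)
  have hlog : 1 / 2 ≤ Real.log ((2 * C * n + 2 * C : ℕ) : ℝ) :=
    one_half_le_log (by exact_mod_cast (by nlinarith))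
  have hC' : (0 : ℝ) ≤ C := Nat.cast_nonneg C
  have hn' : (0 : ℝ) ≤ n := Nat.cast_nonneg n
  have h3 : f (C * n + C) ≤ 2 * (X * Real.log ((2 * C * n + 2 * C : ℕ) : ℝ)) := by
    nlinarith
  have h4 := mul_le_mul_of_nonneg_left h3 hC'
  have h5 : 0 ≤ (C : ℝ) * n := by positivity
  push_cast at h4 ⊢
  linarith

theorem Nat.two_pow_clog_le {n : ℕ} (hn : 0 < n) : 2 ^ Nat.clog 2 n ≤ 2 * n := by
  rcases Nat.eq_or_lt_of_le (Nat.succ_le_of_lt hn) with h | h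
  · simp [← h]
  · have h1 := Nat.pow_pred_clog_lt_self (b := 2) (by norm_num) h
    have h2 : Nat.clog 2 n = Nat.pred (Nat.clog 2 n) + 1 :=
      (Nat.succ_pred_eq_of_pos (Nat.clog_pos (by norm_num) h)).symm
    rw [h2, pow_succ]
    omega

variable {D q : ℕ → ℕ} {c E : ℕ}

/-- Superadditivity lets the doubled cost of one level be absorbed by the closure at the next scale,
so each of the `k` levels adds one term of the same size. The linear terms of the recursion are
already absorbed into `f` by the hypothesis on `D`. -/
theorem dyadicSum_le_closure (hf₀ : ∀ n, 0 < n → 0 ≤ f n) (hE : 0 < E)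
    (hD : ∀ n, 0 < n → (c * D (c * n) + c * n : ℝ) ≤ E * f (E * n)) (k : ℕ) :
    (dyadicSum D c k : ℝ) ≤ 2 ^ k + k * (E * superadditiveClosure f (E * 2 ^ k)) := by
  induction k with
  | zero => simp [dyadicSum]
  | succ k ih =>
    have h1 := hD (2 ^ k) (by positivity)
    have h2 := (superadditiveClosure_mem f).1 (E * 2 ^ k) (E * 2 ^ k) (by positivity) (by positivity)
    have h3 := le_superadditiveClosure f (n := E * 2 ^ k) (by positivity)
    have h4 := superadditiveClosure_nonneg hf₀ (n := E * 2 ^ k) (by positivity)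
    rw [show E * 2 ^ k + E * 2 ^ k = E * 2 ^ (k + 1) by ring] at h2
    have hE' : (0 : ℝ) ≤ E := Nat.cast_nonneg E
    have h5 : k * (E * (2 * superadditiveClosure f (E * 2 ^ k))) ≤
        k * (E * superadditiveClosure f (E * 2 ^ (k + 1))) := by
      gcongr
      linarith
    have h6 : E * f (E * 2 ^ k) ≤ E * superadditiveClosure f (E * 2 ^ (k + 1)) := by
      gcongr
      linarith
    rw [dyadicSum]
    push_cast at h1 ⊢
    rw [pow_succ]
    linarith

/-- Superadditivity of `f n / n` gives `f (2 * N) ≥ 4 * f N`. Then `2 * E * f N` from the previous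
levels and `E * f N` from the new one fit together into `E * f (2 * N)`. -/
theorem dyadicSum_le_of_superadditive_div (hsup : Superadditive fun n => f n / n)
    (hf₀ : ∀ n, 0 < n → 0 ≤ f n) (hE : 0 < E)
    (hD : ∀ n, 0 < n → (c * D (c * n) + c * n : ℝ) ≤ E * f (E * n)) (k : ℕ) :
    (dyadicSum D c k : ℝ) ≤ 2 ^ k + E * f (E * 2 ^ k) := by
  induction k with
  | zero =>
    have : 0 ≤ (E : ℝ) * f (E * 2 ^ 0) := mul_nonneg (Nat.cast_nonneg _) (hf₀ _ (by positivity))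
    simpa [dyadicSum] using this
  | succ k ih =>
    have h1 := hD (2 ^ k) (by positivity)
    have h2 := hsup (E * 2 ^ k) (E * 2 ^ k) (by positivity) (by positivity)
    have h3 : 4 * f (E * 2 ^ k) ≤ f (E * 2 ^ (k + 1)) := by
      dsimp only at h2
      rw [show E * 2 ^ k + E * 2 ^ k = E * 2 ^ (k + 1) by ring] at h2
      have h4 : ((E * 2 ^ (k + 1) : ℕ) : ℝ) = 2 * ((E * 2 ^ k : ℕ) : ℝ) := by push_cast; ring
      have h5 : (0 : ℝ) < ((E * 2 ^ k : ℕ) : ℝ) := by positivity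
      rw [h4, ← add_div, div_le_div_iff₀ h5 (by positivity)] at h2
      refine le_of_mul_le_mul_right ?_ h5
      linarith
    have hE' : (0 : ℝ) ≤ E := Nat.cast_nonneg E
    have h5 := mul_le_mul_of_nonneg_left h3 hE'
    have h6 := mul_nonneg hE' (hf₀ (E * 2 ^ k) (by positivity))
    rw [dyadicSum]
    push_cast at h1 ⊢
    rw [pow_succ]
    linarith

theorem asympLE_superadditiveClosure_mul_log_of_dyadicSum (hf₀ : ∀ n, 0 < n → 0 ≤ f n)
    {C : ℕ} (hc : 0 < c) (hC : 0 < C) (hE : 0 < E)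
    (hD : ∀ n, 0 < n → (c * D (c * n) + c * n : ℝ) ≤ E * f (E * n))
    (hq : ∀ n, q n ≤
      C * (dyadicSum D c (Nat.clog 2 (C * n)) + 2 * D (c * (C * n))) + C * n) :
    AsympLE (fun n => (q n : ℝ)) (fun n => superadditiveClosure f n * Real.log n) := by
  obtain ⟨Z, hZ⟩ : ∃ Z, Z = 6 * C * E + 2 * C * C + C := ⟨_, rfl⟩
  have hZ₀ : 0 < Z := by rw [hZ]; positivity
  refine ⟨Z, hZ₀, fun n hn => ?_⟩
  have hN : 0 < C * n := by positivity
  have hk := Nat.two_pow_clog_le hN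
  set k := Nat.clog 2 (C * n)
  have hEk : E * 2 ^ k ≤ Z * n + Z := by
    have : 2 * E * C * n ≤ Z * n := Nat.mul_le_mul_right n (by rw [hZ]; nlinarith)
    nlinarith
  have hEN : E * (C * n) ≤ Z * n + Z := by
    have : E * C * n ≤ Z * n := Nat.mul_le_mul_right n (by rw [hZ]; nlinarith)
    nlinarith
  have h2k : 2 ^ k ≤ Z * n + Z := by nlinarith [Nat.zero_le (2 ^ k)]
  set X := superadditiveClosure f (Z * n + Z) with hX
  have hX₀ : 0 ≤ X := superadditiveClosure_nonneg hf₀ (by positivity)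
  have h1 := superadditiveClosure_mono hf₀ (by positivity) hEk
  have h2 := (le_superadditiveClosure f (n := E * (C * n)) (by positivity)).trans
    (superadditiveClosure_mono hf₀ (by positivity) hEN)
  set l := Real.log ((Z * n + Z : ℕ) : ℝ) with hl
  have hl2 : 1 / 2 ≤ l := one_half_le_log (by exact_mod_cast (by nlinarith))
  -- The number of levels becomes the logarithm: `k * log 2 ≤ l` and `log 2 > 1 / 2`.
  have hkl : (k : ℝ) ≤ 2 * l := by
    have h3 : Real.log ((2 : ℝ) ^ k) ≤ l :=
      Real.log_le_log (by positivity) (by exact_mod_cast h2k)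
    rw [Real.log_pow] at h3
    have h4 := Real.log_two_gt_d9
    have h5 : (0 : ℝ) ≤ k := Nat.cast_nonneg k
    nlinarith
  have hS := dyadicSum_le_closure hf₀ hE hD k
  have hDN := hD (C * n) hN
  have hc' : (1 : ℝ) ≤ c := by exact_mod_cast hc
  have hC' : (0 : ℝ) ≤ C := Nat.cast_nonneg C
  have hE' : (0 : ℝ) ≤ E := Nat.cast_nonneg E
  have hn' : (0 : ℝ) ≤ n := Nat.cast_nonneg n
  have hD1 : (D (c * (C * n)) : ℝ) ≤ E * X := by
    have h3 := mul_le_mul_of_nonneg_left h2 hE'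
    have h4 : (0 : ℝ) ≤ D (c * (C * n)) := Nat.cast_nonneg _
    have h5 : (0 : ℝ) ≤ c * ((C * n : ℕ) : ℝ) := by positivity
    nlinarith
  have hD2 : (D (c * (C * n)) : ℝ) ≤ 2 * (E * (X * l)) := by
    have : E * X ≤ E * X * (2 * l) := le_mul_of_one_le_right (by positivity) (by linarith)
    linarith
  have hS2 : (k * (E * superadditiveClosure f (E * 2 ^ k)) : ℝ) ≤ 2 * (E * (X * l)) := by
    calc (k * (E * superadditiveClosure f (E * 2 ^ k)) : ℝ) ≤ 2 * l * (E * X) := by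
          gcongr
          exact mul_nonneg hE' (superadditiveClosure_nonneg hf₀ (by positivity))
      _ = _ := by ring
  have hk' : (2 : ℝ) ^ k ≤ 2 * (C * n) := by exact_mod_cast hk
  have hq' : (q n : ℝ) ≤ C * (dyadicSum D c k + 2 * D (c * (C * n))) + C * n := by
    exact_mod_cast hq n
  have h3 : (dyadicSum D c k + 2 * D (c * (C * n)) : ℝ) ≤ 2 * (C * n) + 6 * (E * (X * l)) := by
    linarith
  have h4 := mul_le_mul_of_nonneg_left h3 hC'
  have h5 : (0 : ℝ) ≤ (2 * C * C + C) * (X * l) := by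
    have : 0 ≤ X * l := mul_nonneg hX₀ (by linarith)
    positivity
  have h6 : (0 : ℝ) ≤ 6 * C * E * n + (6 * C * E + 2 * C * C + C) := by positivity
  have hZ' : (Z : ℝ) = 6 * C * E + 2 * C * C + C := by exact_mod_cast hZ
  rw [hZ']
  linarith

theorem asympLE_of_dyadicSum_of_superadditive_div (hsup : Superadditive fun n => f n / n)
    (hf₀ : ∀ n, 0 < n → 0 ≤ f n) (hmono : ∀ n k, 0 < n → n ≤ k → f n ≤ f k)
    {C : ℕ} (hc : 0 < c) (hC : 0 < C) (hE : 0 < E)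
    (hD : ∀ n, 0 < n → (c * D (c * n) + c * n : ℝ) ≤ E * f (E * n))
    (hq : ∀ n, q n ≤
      C * (dyadicSum D c (Nat.clog 2 (C * n)) + 2 * D (c * (C * n))) + C * n) :
    AsympLE (fun n => (q n : ℝ)) f := by
  obtain ⟨Z, hZ⟩ : ∃ Z, Z = 3 * C * E + 2 * C * C + C := ⟨_, rfl⟩
  have hZ₀ : 0 < Z := by rw [hZ]; positivity
  refine ⟨Z, hZ₀, fun n hn => ?_⟩
  have hN : 0 < C * n := by positivity
  have hk := Nat.two_pow_clog_le hN
  set k := Nat.clog 2 (C * n)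
  have hEk : E * 2 ^ k ≤ Z * n + Z := by
    have : 2 * E * C * n ≤ Z * n := Nat.mul_le_mul_right n (by rw [hZ]; nlinarith)
    nlinarith
  have hEN : E * (C * n) ≤ Z * n + Z := by
    have : E * C * n ≤ Z * n := Nat.mul_le_mul_right n (by rw [hZ]; nlinarith)
    nlinarith
  have hX₀ : 0 ≤ f (Z * n + Z) := hf₀ _ (by positivity)
  have h1 := hmono _ _ (by positivity) hEk
  have h2 := hmono _ _ (by positivity) hEN
  set X := f (Z * n + Z)
  have hS := dyadicSum_le_of_superadditive_div hsup hf₀ hE hD k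
  have hDN := hD (C * n) hN
  have hc' : (1 : ℝ) ≤ c := by exact_mod_cast hc
  have hC' : (0 : ℝ) ≤ C := Nat.cast_nonneg C
  have hE' : (0 : ℝ) ≤ E := Nat.cast_nonneg E
  have hn' : (0 : ℝ) ≤ n := Nat.cast_nonneg n
  have hD1 : (D (c * (C * n)) : ℝ) ≤ E * X := by
    have h3 := mul_le_mul_of_nonneg_left h2 hE'
    have h4 : (0 : ℝ) ≤ D (c * (C * n)) := Nat.cast_nonneg _
    have h5 : (0 : ℝ) ≤ c * ((C * n : ℕ) : ℝ) := by positivity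
    nlinarith
  have hS2 := mul_le_mul_of_nonneg_left h1 hE'
  have hk' : (2 : ℝ) ^ k ≤ 2 * (C * n) := by exact_mod_cast hk
  have hq' : (q n : ℝ) ≤ C * (dyadicSum D c k + 2 * D (c * (C * n))) + C * n := by
    exact_mod_cast hq n
  have h3 : (dyadicSum D c k + 2 * D (c * (C * n)) : ℝ) ≤ 2 * (C * n) + 3 * (E * X) := by
    linarith
  have h4 := mul_le_mul_of_nonneg_left h3 hC'
  have h5 : (0 : ℝ) ≤ (2 * C * C + C) * X := by positivity
  have h6 : (0 : ℝ) ≤ 3 * C * E * n + (3 * C * E + 2 * C * C + C) := by positivity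
  have hZ' : (Z : ℝ) = 3 * C * E + 2 * C * C + C := by exact_mod_cast hZ
  rw [hZ']
  linarith

/-- Linear terms are absorbed by a function that dominates a quadratic one. -/
theorem exists_add_le_of_sq_le {p : ℕ → ℕ} (hf₀ : ∀ n, 0 < n → 0 ≤ f n)
    (hmono : ∀ n k, 0 < n → n ≤ k → f n ≤ f k) (hp : AsympLE (fun n => (p n : ℝ)) f)
    {C₀ : ℕ} (hC₀ : 0 < C₀) (hsq : ∀ n, n ^ 2 ≤ C₀ * p (C₀ * n)) :
    ∃ E, 0 < E ∧ ∀ n, 0 < n → (p n + n : ℝ) ≤ E * f (E * n) := by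
  obtain ⟨C, hC, hp⟩ := hp
  have hp' : ∀ n, 0 < n → (p n : ℝ) ≤ C * f (2 * C * n) + 2 * C * n := fun n hn => by
    have h1 := hp n hn
    have h2 := hmono (C * n + C) (2 * C * n) (by positivity) (by nlinarith)
    have h3 := mul_le_mul_of_nonneg_left h2 (Nat.cast_nonneg (α := ℝ) C)
    have h4 : (C : ℝ) ≤ C * n := by exact_mod_cast Nat.le_mul_of_pos_right C hn
    linarith
  -- Evaluating the quadratic bound at `M * n` leaves `(M * n) ^ 2` against the error `(M - 1) * (M
  -- * n)`. Their difference is at least `n`, so `f` itself dominates a linear function.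
  obtain ⟨M, hM⟩ : ∃ M, M = 2 * C * C₀ * C₀ + 1 := ⟨_, rfl⟩
  have hlin : ∀ n : ℕ, 0 < n → (n : ℝ) ≤ C₀ * C * f (2 * C * (C₀ * (M * n))) := fun n hn => by
    have hM₀ : 0 < M := by omega
    have h1 : ((M * n : ℕ) : ℝ) ^ 2 ≤ C₀ * p (C₀ * (M * n)) := by exact_mod_cast hsq (M * n)
    have h2 := hp' (C₀ * (M * n)) (by positivity)
    have h3 := mul_le_mul_of_nonneg_left h2 (Nat.cast_nonneg (α := ℝ) C₀)
    have hM' : (M : ℝ) = 2 * C * C₀ * C₀ + 1 := by exact_mod_cast hM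
    have hn' : (1 : ℝ) ≤ n := by exact_mod_cast hn
    have h5 : (1 : ℝ) ≤ M := by exact_mod_cast hM₀
    have h6 : (n : ℝ) ≤ (M * n) ^ 2 - 2 * C * C₀ * C₀ * (M * n) := by
      have h7 : (2 * C * C₀ * C₀ : ℝ) = M - 1 := by linarith
      have h8 : (n : ℝ) ≤ M * n := le_mul_of_one_le_left (by linarith) h5
      have h9 : (1 : ℝ) ≤ M * n - (M - 1) := by nlinarith
      rw [h7]
      nlinarith
    push_cast at h1 h3
    linarith
  refine ⟨C + (2 * C + 1) * (C₀ * C) + 2 * C + 2 * C * C₀ * M, by positivity, fun n hn => ?_⟩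
  obtain ⟨E, hE⟩ : ∃ E, E = C + (2 * C + 1) * (C₀ * C) + 2 * C + 2 * C * C₀ * M := ⟨_, rfl⟩
  rw [← hE]
  have h1 := hp' n hn
  have h2 := hlin n hn
  have h3 := hmono (2 * C * n) (E * n) (by positivity)
    (Nat.mul_le_mul_right n (by omega))
  have h4 := hmono (2 * C * (C₀ * (M * n))) (E * n) (by rw [hM]; positivity) (by
    rw [show 2 * C * (C₀ * (M * n)) = 2 * C * C₀ * M * n by ring]
    exact Nat.mul_le_mul_right n (by omega))
  have hX₀ : 0 ≤ f (E * n) := hf₀ _ (Nat.mul_pos (by omega) hn)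
  set X := f (E * n)
  have hC' : (0 : ℝ) ≤ C := Nat.cast_nonneg C
  have h5 := mul_le_mul_of_nonneg_left h3 hC'
  have h6 : (n : ℝ) ≤ C₀ * C * X := h2.trans (by gcongr)
  have h7 : (2 * C + 1) * (n : ℝ) ≤ (2 * C + 1) * (C₀ * C * X) := by gcongr
  have h8 : (0 : ℝ) ≤ (2 * C + 2 * C * C₀ * M) * X := by positivity
  have hE' : (E : ℝ) = C + (2 * C + 1) * (C₀ * C) + 2 * C + 2 * C * C₀ * M := by
    exact_mod_cast hE
  rw [hE']
  linarith

end Asymptotics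

/-! ### The kernel of the sum homomorphism as a gluing of three products. -/

section Coabelian

variable {G₁ G₂ G₃ : Type*} [Group G₁] [Group G₂] [Group G₃] {m : ℕ}
  {φ₁ : G₁ →* FreeAb m} {φ₂ : G₂ →* FreeAb m} {φ₃ : G₃ →* FreeAb m}

theorem mem_ker_sumHom {g : G₁ × G₂ × G₃} :
    g ∈ (sumHom φ₁ φ₂ φ₃).ker ↔ φ₁ g.1 * (φ₂ g.2.1 * φ₃ g.2.2) = 1 := by
  rw [MonoidHom.mem_ker, sumHom, MonoidHom.coprod_apply, MonoidHom.coprod_apply]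

/-- The copy of `G₁ × G₂` in the kernel that is defined by a section of `φ₃`. -/
def kerIncl₁₂ (φ₁ : G₁ →* FreeAb m) (φ₂ : G₂ →* FreeAb m) {s₃ : FreeAb m →* G₃}
    (h₃ : φ₃.comp s₃ = MonoidHom.id _) : G₁ × G₂ →* (sumHom φ₁ φ₂ φ₃).ker :=
  ((MonoidHom.fst G₁ G₂).prod ((MonoidHom.snd G₁ G₂).prod
    (s₃.comp (φ₁.coprod φ₂)⁻¹))).codRestrict _ fun g => by
      have h : φ₃ (s₃ (φ₁ g.1 * φ₂ g.2)) = φ₁ g.1 * φ₂ g.2 := DFunLike.congr_fun h₃ _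
      simp only [mem_ker_sumHom, MonoidHom.prod_apply, MonoidHom.comp_apply, MonoidHom.inv_apply,
        MonoidHom.coprod_apply, map_inv, h, MonoidHom.coe_fst, MonoidHom.coe_snd]
      group

/-- The copy of `G₁ × G₃` in the kernel that is defined by a section of `φ₂`. -/
def kerIncl₁₃ (φ₁ : G₁ →* FreeAb m) (φ₃ : G₃ →* FreeAb m) {s₂ : FreeAb m →* G₂}
    (h₂ : φ₂.comp s₂ = MonoidHom.id _) : G₁ × G₃ →* (sumHom φ₁ φ₂ φ₃).ker :=
  ((MonoidHom.fst G₁ G₃).prod ((s₂.comp (φ₁.coprod φ₃)⁻¹).prod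
    (MonoidHom.snd G₁ G₃))).codRestrict _ fun g => by
      have h : φ₂ (s₂ (φ₁ g.1 * φ₃ g.2)) = φ₁ g.1 * φ₃ g.2 := DFunLike.congr_fun h₂ _
      simp only [mem_ker_sumHom, MonoidHom.prod_apply, MonoidHom.comp_apply, MonoidHom.inv_apply,
        MonoidHom.coprod_apply, map_inv, h, MonoidHom.coe_fst, MonoidHom.coe_snd]
      rw [mul_inv]
      simp [mul_comm]

/-- The copy of `G₂ × G₃` in the kernel that is defined by a section of `φ₁`. -/
def kerIncl₂₃ (φ₂ : G₂ →* FreeAb m) (φ₃ : G₃ →* FreeAb m) {s₁ : FreeAb m →* G₁}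
    (h₁ : φ₁.comp s₁ = MonoidHom.id _) : G₂ × G₃ →* (sumHom φ₁ φ₂ φ₃).ker :=
  ((s₁.comp (φ₂.coprod φ₃)⁻¹).prod (MonoidHom.id _)).codRestrict _ fun g => by
      have h : φ₁ (s₁ (φ₂ g.1 * φ₃ g.2)) = φ₂ g.1 * φ₃ g.2 := DFunLike.congr_fun h₁ _
      simp only [mem_ker_sumHom, MonoidHom.prod_apply, MonoidHom.comp_apply, MonoidHom.inv_apply,
        MonoidHom.coprod_apply, map_inv, h, MonoidHom.id_apply]
      group

theorem coe_kerIncl₁₂ {s₃ : FreeAb m →* G₃} (h₃ : φ₃.comp s₃ = MonoidHom.id _) (g : G₁ × G₂) :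
    (kerIncl₁₂ φ₁ φ₂ h₃ g : G₁ × G₂ × G₃) = (g.1, g.2, s₃ (φ₁ g.1 * φ₂ g.2)⁻¹) := rfl

theorem coe_kerIncl₁₃ {s₂ : FreeAb m →* G₂} (h₂ : φ₂.comp s₂ = MonoidHom.id _) (g : G₁ × G₃) :
    (kerIncl₁₃ φ₁ φ₃ h₂ g : G₁ × G₂ × G₃) = (g.1, s₂ (φ₁ g.1 * φ₃ g.2)⁻¹, g.2) := rfl

theorem coe_kerIncl₂₃ {s₁ : FreeAb m →* G₁} (h₁ : φ₁.comp s₁ = MonoidHom.id _) (g : G₂ × G₃) :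
    (kerIncl₂₃ φ₂ φ₃ h₁ g : G₁ × G₂ × G₃) = (s₁ (φ₂ g.1 * φ₃ g.2)⁻¹, g.1, g.2) := rfl

theorem map_section_mul_eq_one {s₃ : FreeAb m →* G₃} (h₃ : φ₃.comp s₃ = MonoidHom.id _)
    (k : (sumHom φ₁ φ₂ φ₃).ker) :
    φ₃ (s₃ (φ₁ k.1.1 * φ₂ k.1.2.1) * k.1.2.2) = 1 := by
  have h : φ₃ (s₃ (φ₁ k.1.1 * φ₂ k.1.2.1)) = φ₁ k.1.1 * φ₂ k.1.2.1 := DFunLike.congr_fun h₃ _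
  rw [map_mul, h, mul_assoc]
  exact mem_ker_sumHom.1 k.2

/-- The kernel of `sumHom` is glued from the products of two of the factors. -/
def kerProductTriangle {s₁ : FreeAb m →* G₁} {s₂ : FreeAb m →* G₂} {s₃ : FreeAb m →* G₃}
    (h₁ : φ₁.comp s₁ = MonoidHom.id _) (h₂ : φ₂.comp s₂ = MonoidHom.id _)
    (h₃ : φ₃.comp s₃ = MonoidHom.id _)
    (P₁ : FinitePresentation G₁) (P₂ : FinitePresentation G₂) (P₃ : FinitePresentation G₃)
    (P₁₂ : FinitePresentation (G₁ × G₂)) (P₁₃ : FinitePresentation (G₁ × G₃))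
    (P₂₃ : FinitePresentation (G₂ × G₃)) :
    ProductTriangle G₁ G₂ G₃ (sumHom φ₁ φ₂ φ₃).ker where
  P₁ := P₁
  P₂ := P₂
  P₃ := P₃
  P₁₂ := P₁₂
  P₁₃ := P₁₃
  P₂₃ := P₂₃
  j₁₂ := kerIncl₁₂ φ₁ φ₂ h₃
  j₁₃ := kerIncl₁₃ φ₁ φ₃ h₂
  j₂₃ := kerIncl₂₃ φ₂ φ₃ h₁
  -- Both descriptions of `a` are `(a, 1, s₃ (φ₁ a)⁻¹)`: in the copy of `G₁ × G₃` the middle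
  -- coordinate is trivial because the images of the outer ones cancel. The other two maps arise in
  -- the same way.
  t₁₃ := s₃.comp φ₁⁻¹
  t₂₃ := s₃.comp φ₂⁻¹
  t₃₁ := s₁.comp φ₃⁻¹
  π := ((MonoidHom.fst _ _).prod ((MonoidHom.fst _ _).comp (MonoidHom.snd _ _))).comp
    (Subgroup.subtype _)
  -- For `k = (g₁, g₂, g₃)` the fibre is `s₃ (φ₁ g₁ * φ₂ g₂) * g₃`, which corrects the third
  -- coordinate chosen by the section and lies in `ker φ₃`.
  σ := (s₃.comp (φ₁.coprod (φ₂.comp (MonoidHom.fst _ _)))).comp (Subgroup.subtype _)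
  ρ := ((MonoidHom.snd _ _).comp (MonoidHom.snd _ _)).comp (Subgroup.subtype _)
  j₁₂_left a := by
    have h : ∀ x, φ₃ (s₃ x) = x := DFunLike.congr_fun h₃
    ext <;> simp [coe_kerIncl₁₂, coe_kerIncl₁₃, h]
  j₁₂_right b := by
    have h : ∀ x, φ₃ (s₃ x) = x := DFunLike.congr_fun h₃
    ext <;> simp [coe_kerIncl₁₂, coe_kerIncl₂₃, h]
  j₂₃_right c := by
    have h : ∀ x, φ₁ (s₁ x) = x := DFunLike.congr_fun h₁
    ext <;> simp [coe_kerIncl₁₃, coe_kerIncl₂₃, h]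
  j₁₃_injective g g' h := by
    have h' := congrArg Subtype.val h
    rw [coe_kerIncl₁₃, coe_kerIncl₁₃] at h'
    simp only [Prod.mk.injEq] at h'
    exact Prod.ext h'.1 h'.2.2
  decomposition k := by
    have hk := map_section_mul_eq_one h₃ k
    ext
    · simp [coe_kerIncl₁₂, coe_kerIncl₁₃]
    · simp [coe_kerIncl₁₂, coe_kerIncl₁₃, hk, -map_mul]
    · simp [coe_kerIncl₁₂, coe_kerIncl₁₃, mul_assoc]
  t₃₁_eq_one k := by
    have hk := map_section_mul_eq_one h₃ k
    simp [hk, -map_mul]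

/-- The `i`-th coordinate of `ℤ^m`. -/
def FreeAb.coord (i : Fin m) : FreeAb m →* Multiplicative ℤ :=
  AddMonoidHom.toMultiplicative (Pi.evalAddMonoidHom (fun _ => ℤ) i)

theorem FreeAb.coord_ofAdd_single (i : Fin m) :
    FreeAb.coord i (Multiplicative.ofAdd (Pi.single i 1)) = Multiplicative.ofAdd 1 := by
  simp [FreeAb.coord]

theorem exists_sq_le_dehn_prod (i : Fin m) {s₁ : FreeAb m →* G₁} {s₂ : FreeAb m →* G₂}
    (h₁ : φ₁.comp s₁ = MonoidHom.id _) (h₂ : φ₂.comp s₂ = MonoidHom.id _)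
    (P : FinitePresentation (G₁ × G₂ × G₃)) :
    ∃ C, 0 < C ∧ ∀ n, n ^ 2 ≤ C * P.dehn (C * n) := by
  have h : ∀ x, φ₁ (s₁ x) = x := DFunLike.congr_fun h₁
  have h' : ∀ x, φ₂ (s₂ x) = x := DFunLike.congr_fun h₂
  let e : FreeAb m := Multiplicative.ofAdd (Pi.single i 1)
  refine P.exists_sq_le_dehn
    (((FreeAb.coord i).comp (φ₁.comp (MonoidHom.fst _ _))).prod
      ((FreeAb.coord i).comp (φ₂.comp ((MonoidHom.fst _ _).comp (MonoidHom.snd _ _)))))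
    (a := (s₁ e, 1, 1)) (b := (1, s₂ e, 1)) ?_ ?_ ?_
  · simp
  · simp [h, e, FreeAb.coord_ofAdd_single]
  · simp [h', e, FreeAb.coord_ofAdd_single]

theorem exists_sq_le_dehn_ker (i : Fin m) {s₁ : FreeAb m →* G₁} {s₂ : FreeAb m →* G₂}
    {s₃ : FreeAb m →* G₃}
    (h₁ : φ₁.comp s₁ = MonoidHom.id _) (h₂ : φ₂.comp s₂ = MonoidHom.id _)
    (h₃ : φ₃.comp s₃ = MonoidHom.id _) (Q : FinitePresentation (sumHom φ₁ φ₂ φ₃).ker) :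
    ∃ C, 0 < C ∧ ∀ n, n ^ 2 ≤ C * Q.dehn (C * n) := by
  have h : ∀ x, φ₁ (s₁ x) = x := DFunLike.congr_fun h₁
  have h' : ∀ x, φ₂ (s₂ x) = x := DFunLike.congr_fun h₂
  let e : FreeAb m := Multiplicative.ofAdd (Pi.single i 1)
  refine Q.exists_sq_le_dehn
    ((((FreeAb.coord i).comp (φ₁.comp (MonoidHom.fst _ _))).prod
      ((FreeAb.coord i).comp (φ₂.comp ((MonoidHom.fst _ _).comp (MonoidHom.snd _ _))))).comp
      (Subgroup.subtype _))
    (a := kerIncl₁₂ φ₁ φ₂ h₃ (s₁ e, 1)) (b := kerIncl₁₂ φ₁ φ₂ h₃ (1, s₂ e)) ?_ ?_ ?_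
  · rw [← map_mul, ← map_mul]
    simp
  · simp [coe_kerIncl₁₂, h, e, FreeAb.coord_ofAdd_single]
  · simp [coe_kerIncl₁₂, h', e, FreeAb.coord_ofAdd_single]

/-- The Dehn function of the product is bounded by that of the kernel if `m > 0`. -/
theorem asympLE_dehn_prod_dehn_ker (i : Fin m) {s₁ : FreeAb m →* G₁} {s₂ : FreeAb m →* G₂}
    {s₃ : FreeAb m →* G₃}
    (h₁ : φ₁.comp s₁ = MonoidHom.id _) (h₂ : φ₂.comp s₂ = MonoidHom.id _)
    (h₃ : φ₃.comp s₃ = MonoidHom.id _)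
    (P₁ : FinitePresentation G₁) (P₂₃ : FinitePresentation (G₂ × G₃))
    (P : FinitePresentation (G₁ × G₂ × G₃)) (Q : FinitePresentation (sumHom φ₁ φ₂ φ₃).ker) :
    AsympLE (fun n => (P.dehn n : ℝ)) (fun n => (Q.dehn n : ℝ)) := by
  -- The triple product is read as `G₁ × (G₂ × G₃)`: both factors are retracts of the kernel, and
  -- the quadratic term is bounded by its Dehn function.
  obtain ⟨C, hC⟩ := (P₁.isFinitelyPresented_prod_and_dehn_le P₂₃).2 P
  obtain ⟨a, -, ha⟩ := P₁.exists_dehn_le_dehn_of_retract Q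
    ((kerIncl₁₂ φ₁ φ₂ h₃).comp (MonoidHom.inl _ _))
    ((MonoidHom.fst _ _).comp (Subgroup.subtype _)) fun _ => rfl
  obtain ⟨b, -, hb⟩ := P₂₃.exists_dehn_le_dehn_of_retract Q (kerIncl₂₃ φ₂ φ₃ h₁)
    ((MonoidHom.snd _ _).comp (Subgroup.subtype _)) fun _ => rfl
  obtain ⟨c, hc₀, hc⟩ := exists_sq_le_dehn_ker i h₁ h₂ h₃ Q
  obtain ⟨E, hE⟩ : ∃ E, E = C * (a + b + c + a * C + b * C) + (a * C + b * C + c) := ⟨_, rfl⟩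
  refine asympLE_of_le Q.dehn_mono (C := E) (by omega) fun n => (hC n).trans ?_
  have hla : a * (C * n) ≤ E * n := by
    rw [← mul_assoc]; exact Nat.mul_le_mul_right n (by omega)
  have hlb : b * (C * n) ≤ E * n := by
    rw [← mul_assoc]; exact Nat.mul_le_mul_right n (by omega)
  have hlc : c * n ≤ E * n := Nat.mul_le_mul_right n (by omega)
  have h1 := (ha (C * n)).trans
    (Nat.add_le_add_right (Nat.mul_le_mul_left a (Q.dehn_mono hla)) _)
  have h2 := (hb (C * n)).trans
    (Nat.add_le_add_right (Nat.mul_le_mul_left b (Q.dehn_mono hlb)) _)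
  have h3 := (hc n).trans (Nat.mul_le_mul_left c (Q.dehn_mono hlc))
  have h4 : C * (a + b + c + a * C + b * C) ≤ E := by omega
  calc C * (P₁.dehn (C * n) + P₂₃.dehn (C * n) + n ^ 2)
      ≤ C * ((a * Q.dehn (E * n) + a * (C * n)) + (b * Q.dehn (E * n) + b * (C * n)) +
          c * Q.dehn (E * n)) :=
        Nat.mul_le_mul_left C (add_le_add (add_le_add h1 h2) h3)
    _ = C * (a + b + c) * Q.dehn (E * n) + C * (a * C + b * C) * n := by ring
    _ ≤ E * Q.dehn (E * n) + E * n :=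
        add_le_add (Nat.mul_le_mul_right _ (h4.trans' (Nat.mul_le_mul_left C (by omega))))
          (Nat.mul_le_mul_right _ (h4.trans' (Nat.mul_le_mul_left C (by omega))))

/-- If each of three functions is bounded by `p`, and `f` absorbs linear terms, then their sum is
bounded by `f`. -/
theorem exists_sum_le {p a b d : ℕ → ℕ} {f : ℕ → ℝ} (hp : Monotone p)
    (hf₀ : ∀ n, 0 < n → 0 ≤ f n) (hmono : ∀ n k, 0 < n → n ≤ k → f n ≤ f k)
    (hpf : ∃ E, 0 < E ∧ ∀ n, 0 < n → (p n + n : ℝ) ≤ E * f (E * n))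
    (ha : ∃ C, 0 < C ∧ ∀ n, a n ≤ C * p (C * n) + C * n)
    (hb : ∃ C, 0 < C ∧ ∀ n, b n ≤ C * p (C * n) + C * n)
    (hd : ∃ C, 0 < C ∧ ∀ n, d n ≤ C * p (C * n) + C * n) (c : ℕ) :
    ∃ E, 0 < E ∧ ∀ n, 0 < n →
      (c * ((a (c * n) + b (c * n) + d (c * n) : ℕ) : ℝ) + c * n : ℝ) ≤ E * f (E * n) := by
  obtain ⟨A, hA₀, hA⟩ := ha
  obtain ⟨B, hB₀, hB⟩ := hb
  obtain ⟨D, hD₀, hD⟩ := hd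
  obtain ⟨E, hE₀, hE⟩ := hpf
  obtain ⟨M, hM⟩ : ∃ M, M = A + B + D := ⟨_, rfl⟩
  have hM₀ : 0 < M := by omega
  have hsum : ∀ C : ℕ, C ≤ M → ∀ n, C * p (C * (c * n)) + C * (c * n) ≤
      M * (c + 1) * (p (M * (c + 1) * n) + n) := fun C hC n => by
    have h1 : C * (c * n) ≤ M * (c + 1) * n := by
      rw [← mul_assoc]
      exact Nat.mul_le_mul_right n (Nat.mul_le_mul hC (by omega))
    have h2 : C * p (C * (c * n)) ≤ M * (c + 1) * p (M * (c + 1) * n) :=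
      Nat.mul_le_mul (by nlinarith) (hp h1)
    rw [mul_add]
    exact add_le_add h2 h1
  obtain ⟨L, hL⟩ : ∃ L, L = M * (c + 1) := ⟨_, rfl⟩
  have hL₀ : 0 < L := by rw [hL]; positivity
  refine ⟨(c * (3 * L) + c + 1) * E * L, by positivity, fun n hn => ?_⟩
  have h1 : c * (a (c * n) + b (c * n) + d (c * n)) + c * n ≤
      (c * (3 * L) + c + 1) * (p (L * n) + L * n) := by
    have e1 := (hA (c * n)).trans (hsum A (by omega) n)
    have e2 := (hB (c * n)).trans (hsum B (by omega) n)
    have e3 := (hD (c * n)).trans (hsum D (by omega) n)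
    rw [← hL] at e1 e2 e3
    have e4 : p (L * n) + n ≤ p (L * n) + L * n :=
      Nat.add_le_add_left (Nat.le_mul_of_pos_left n hL₀) _
    have e5 : a (c * n) + b (c * n) + d (c * n) ≤ 3 * L * (p (L * n) + L * n) := by
      have := Nat.mul_le_mul_left L e4
      linarith
    have e6 := Nat.mul_le_mul_left c e5
    have e7 : c * n ≤ c * (p (L * n) + L * n) := Nat.mul_le_mul_left c (by omega)
    linarith
  have h2 := hE (L * n) (by positivity)
  have h3 := hmono (E * (L * n)) ((c * (3 * L) + c + 1) * E * L * n) (by positivity) (by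
    rw [show (c * (3 * L) + c + 1) * E * L * n = (c * (3 * L) + c + 1) * (E * (L * n)) by ring]
    exact Nat.le_mul_of_pos_left _ (by omega))
  have h4 : (c * ((a (c * n) + b (c * n) + d (c * n) : ℕ) : ℝ) + c * n : ℝ) ≤
      (c * (3 * L) + c + 1) * (p (L * n) + ((L * n : ℕ) : ℝ)) := by exact_mod_cast h1
  have hX₀ : 0 ≤ f ((c * (3 * L) + c + 1) * E * L * n) := hf₀ _ (by positivity)
  set X := f ((c * (3 * L) + c + 1) * E * L * n)
  have hL' : (1 : ℝ) ≤ L := by exact_mod_cast hL₀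
  calc (c * ((a (c * n) + b (c * n) + d (c * n) : ℕ) : ℝ) + c * n : ℝ)
      ≤ (c * (3 * L) + c + 1) * (E * X) := h4.trans (by
        gcongr
        exact h2.trans (by gcongr))
    _ ≤ (c * (3 * L) + c + 1) * (E * X) * L := le_mul_of_one_le_right (by positivity) hL'
    _ = _ := by push_cast; ring

end Coabelian

/-! ### The theorem. -/

/-- Here `f` is any non-negative, non-decreasing function in the asymptotic equivalence class of
the Dehn function of `G₁ × G₂ × G₃`; the choice `f = P.dehn` is allowed. -/
theorem mainTheorem1 {G₁ G₂ G₃ : Type*} [Group G₁] [Group G₂] [Group G₃]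
    [Group.IsFinitelyPresented G₁] [Group.IsFinitelyPresented G₂] [Group.IsFinitelyPresented G₃]
    (m : ℕ) (φ₁ : G₁ →* FreeAb m) (φ₂ : G₂ →* FreeAb m) (φ₃ : G₃ →* FreeAb m)
    (h₁ : RightSplit φ₁) (h₂ : RightSplit φ₂) (h₃ : RightSplit φ₃) :
    Group.IsFinitelyPresented (sumHom φ₁ φ₂ φ₃).ker ∧
      ∀ (P : FinitePresentation (G₁ × G₂ × G₃)) (f : ℕ → ℝ),
        (∀ n, 0 < n → 0 ≤ f n) → (∀ n k, 0 < n → n ≤ k → f n ≤ f k) →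
        AsympEq f (fun n => (P.dehn n : ℝ)) →
        ∀ Q : FinitePresentation (sumHom φ₁ φ₂ φ₃).ker,
          AsympLE f (fun n => (Q.dehn n : ℝ)) ∧
          AsympLE (fun n => (Q.dehn n : ℝ)) (fun n => superadditiveClosure f n * Real.log n) ∧
          (Superadditive (fun n => f n / n) → AsympEq f (fun n => (Q.dehn n : ℝ))) := by
  obtain ⟨s₁, h₁⟩ := h₁
  obtain ⟨s₂, h₂⟩ := h₂
  obtain ⟨s₃, h₃⟩ := h₃
  obtain ⟨P₁⟩ := (nonempty_finitePresentation_iff G₁).2 inferInstance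
  obtain ⟨P₂⟩ := (nonempty_finitePresentation_iff G₂).2 inferInstance
  obtain ⟨P₃⟩ := (nonempty_finitePresentation_iff G₃).2 inferInstance
  obtain ⟨P₁₂⟩ := (nonempty_finitePresentation_iff (G₁ × G₂)).2
    (P₁.isFinitelyPresented_prod_and_dehn_le P₂).1
  obtain ⟨P₁₃⟩ := (nonempty_finitePresentation_iff (G₁ × G₃)).2
    (P₁.isFinitelyPresented_prod_and_dehn_le P₃).1
  obtain ⟨P₂₃⟩ := (nonempty_finitePresentation_iff (G₂ × G₃)).2
    (P₂.isFinitelyPresented_prod_and_dehn_le P₃).1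
  let T := kerProductTriangle h₁ h₂ h₃ P₁ P₂ P₃ P₁₂ P₁₃ P₂₃
  refine ⟨T.isFinitelyPresented, fun P f hf₀ hmono hfP Q => ?_⟩
  have hQ₀ : ∀ n, 0 < n → (0 : ℝ) ≤ Q.dehn n := fun n _ => Nat.cast_nonneg _
  have hQm : ∀ n k, 0 < n → n ≤ k → (Q.dehn n : ℝ) ≤ Q.dehn k := fun n k _ hnk =>
    Nat.cast_le.2 (Q.dehn_mono hnk)
  -- For `m = 0` the kernel is the whole product, and retraction in both directions gives
  -- equivalence. This case is separate because the quadratic lower bounds need a coordinate of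
  -- `ℤ^m`.
  rcases Nat.eq_zero_or_pos m with rfl | hm
  · have hker : ∀ g, g ∈ (sumHom φ₁ φ₂ φ₃).ker := fun g => Subsingleton.elim _ _
    let i : G₁ × G₂ × G₃ →* (sumHom φ₁ φ₂ φ₃).ker := (MonoidHom.id _).codRestrict _ hker
    obtain ⟨C, hC₀, hC⟩ := P.exists_dehn_le_dehn_of_retract Q i (Subgroup.subtype _) fun _ => rfl
    obtain ⟨D, hD₀, hD⟩ := Q.exists_dehn_le_dehn_of_retract P (Subgroup.subtype _) i fun _ => rfl
    have hfQ := hfP.1.trans (asympLE_of_le Q.dehn_mono hC₀ hC) hQ₀ hQm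
    have hQf := (asympLE_of_le P.dehn_mono hD₀ hD).trans hfP.2 hf₀ hmono
    exact ⟨hfQ, hQf.superadditiveClosure_mul_log hf₀, fun _ => ⟨hfQ, hQf⟩⟩
  · let i : Fin m := ⟨0, hm⟩
    have hfQ := hfP.1.trans (asympLE_dehn_prod_dehn_ker i h₁ h₂ h₃ P₁ P₂₃ P Q) hQ₀ hQm
    obtain ⟨c₀, hc₀, hsq⟩ := exists_sq_le_dehn_prod i h₁ h₂ P
    obtain ⟨c, C, hc, hC, hQ⟩ := T.exists_dehn_le Q
    -- Each product of two factors is a retract of the triple product, so `dehnSum` is controlled by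
    -- `f`. The quadratic lower bound absorbs the linear errors, which would otherwise contribute `n
    -- * log n` to the recursion.
    obtain ⟨E, hE, hD⟩ := exists_sum_le P.dehn_mono hf₀ hmono
      (exists_add_le_of_sq_le hf₀ hmono hfP.2 hc₀ hsq)
      (P₁₂.exists_dehn_le_dehn_of_retract P
        ((MonoidHom.fst _ _).prod ((MonoidHom.snd _ _).prod 1))
        ((MonoidHom.fst _ _).prod ((MonoidHom.fst _ _).comp (MonoidHom.snd _ _))) fun _ => rfl)
      (P₁₃.exists_dehn_le_dehn_of_retract P
        ((MonoidHom.fst _ _).prod (MonoidHom.prod 1 (MonoidHom.snd _ _)))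
        ((MonoidHom.fst _ _).prod ((MonoidHom.snd _ _).comp (MonoidHom.snd _ _))) fun _ => rfl)
      (P₂₃.exists_dehn_le_dehn_of_retract P (MonoidHom.inr _ _) (MonoidHom.snd _ _) fun _ => rfl) c
    exact ⟨hfQ, asympLE_superadditiveClosure_mul_log_of_dyadicSum hf₀ hc hC hE hD hQ,
      fun hsup => ⟨hfQ, asympLE_of_dyadicSum_of_superadditive_div hsup hf₀ hmono hc hC hE hD hQ⟩⟩
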